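/- **Setting.** Let $G$ be a (typically infinite) weighted bipartite planar graph, drawn in $\mathbb C$ with straight edges which meet only at common endpoints, in a locally finite way (every bounded set meets finitely many vertices and edges), with positive edge weights $w(e)$, such that $0$ lies on no edge. (The main example is the hexagonal lattice with $w\equiv 1$, i.e. lozenge tilings.) A *domain* $D$ is a finite set of vertices, identified with the induced subgraph; a *configuration* on $D$ is a perfect matching $M$ of it, and the *dimer measure* on $D$ gives $M$ a mass proportional to $\prod_{e\in M}w(e)$ (the uniform measure if $w\equiv1$). Domains are assumed to have at least one configuration. If $D$ is random, the dimer measure on $D$ is the law of $M$ when, given $D$, $M$ is sampled from the dimer measure on $D$. We say that $D$ *contains $0$* if the face of $G$ containing $0$ has a vertex in $D$. **Local convergence.** Configurations are seen as closed subsets of $\mathbb C$, with the distance $d(E,F)=\exp(-\max\{R: E\cap B(0,R)=F\cap B(0,R)\})$. Local convergence (around $0$) is convergence in law for $d$. **Heights.** Fix a reference flow $\omega$, i.e. real numbers $\omega(e)$ with $\sum_{e\ni v}\omega(e)=1$ for every vertex $v$. A *height function* of a configuration $M$ on $D$ is a function $h_M$ on the faces of $G$ such that, when one crosses an edge $e$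 with an endpoint in $D$ from the right to the left of its white-to-black orientation, $h_M$ changes by $\mathbf 1_{e\in M}-\omega(e)$. For a perfect matching of the whole graph (where $D$ is replaced by the set of all vertices) it is unique up to an additive constant. On a domain $D$ the additive constants are fixed on the boundary: every face having a vertex in $D$ is connected, by crossing edges with an endpoint in $D$, to a face of $\partial D$ at which $h_M$ does not depend on $M$. Here $\partial D$ is the set of faces of $G$ that have both a vertex in $D$ and a vertex outside $D$. **Spread-out property.** For $R>0$ and a perfect matching $m$ of $G$, let $\pi(R,m)$ be the dimer measure on the perfect matchings of $G$ that agree with $m$ outside $B(0,R)$. A probability measure $\mu$ on perfect matchings of $G$ is *spread-out* if for every $\varepsilon>0$ there is $R>0$ such that $$\mathbb P_\mu\Big[\forall x\in\mathbb R,\ \mathbb P_{\pi(R,M)}\big[h(0)\in(x,x+1)\big]\le\varepsilon\Big]>1-\varepsilon,$$ where $h(0)$ is the height of the face containing $0$, for the height function normalized by fixing its value at any point outside $B(0,R)$. **Theorem.** Let $\mu$ be a spread-out probability measure on perfect matchings of $G$, and let $(D_n)$, $(D'_n)$ be two sequences of (possibly random) domains containing $0$, defined on the same probability space. Assume that the dimer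 measures on $D_n$ converge locally around $0$ to $\mu$, and that there is a constant $K>0$ such that, for almost all realisations of $(D_n,D'_n)_n$, for every $n$ and all configurations $M$ on $D_n$ and $M'$ on $D'_n$, $$\sup_{v\in\partial(D_n\cap D'_n)}|h_{M'}(v)-h_M(v)|\le K,$$ for suitable normalized height functions on $D_n$ and on $D'_n$ (the additive constants may depend on the realisation and on $n$, but not on the configurations). Then the dimer measures on $D'_n$ also converge locally around $0$ to $\mu$. -/

import Mathlib

open Filter Topology MeasureTheory

/-- A weighted bipartite graph drawn in the plane: vertices are distinct points, edges are the
straight segments joining their endpoints, distinct edges meet only at common endpoints, no edge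
passes through a further vertex, and every bounded region meets only finitely many vertices and
edges. Every edge carries a positive weight. -/
structure PlaneBipartiteGraph (V : Type*) where
  graph : SimpleGraph V
  white : Set V
  bipartite : ∀ u v, graph.Adj u v → (u ∈ white ↔ v ∉ white)
  pos : V → ℂ
  pos_injective : Function.Injective pos
  noncrossing : ∀ u v u' v', graph.Adj u v → graph.Adj u' v' → s(u, v) ≠ s(u', v') →
    ∀ z ∈ segment ℝ (pos u) (pos v) ∩ segment ℝ (pos u') (pos v'),
      ∃ x, pos x = z ∧ x ∈ s(u, v) ∧ x ∈ s(u', v')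
  no_vertex_inside : ∀ u v x, graph.Adj u v → pos x ∈ segment ℝ (pos u) (pos v) → x ∈ s(u, v)
  finite_vertices : ∀ R : ℝ, {v | ‖pos v‖ ≤ R}.Finite
  finite_edges : ∀ R : ℝ, {e : graph.edgeSet | ∃ u v, e.1 = s(u, v) ∧
    (segment ℝ (pos u) (pos v) ∩ Metric.closedBall 0 R).Nonempty}.Finite
  weight : graph.edgeSet → ℝ
  weight_pos : ∀ e, 0 < weight e

namespace PlaneBipartiteGraph

variable {V : Type*} (G : PlaneBipartiteGraph V)

abbrev Edge : Type _ := G.graph.edgeSet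

/-- Edge configurations, with the product sigma-algebra. -/
abbrev Config : Type _ := Set G.Edge

/-- The closed segment that represents an edge. -/
def edgeSegment (e : G.Edge) : Set ℂ :=
  {z | ∃ u v, e.1 = s(u, v) ∧ z ∈ segment ℝ (G.pos u) (G.pos v)}

/-- A configuration seen as a closed subset of the plane. -/
def drawing (M : G.Config) : Set ℂ := ⋃ e ∈ M, G.edgeSegment e

/-- The union of all edges of the graph. -/
def skeleton : Set ℂ := G.drawing Set.univ

/-- The face containing the point `z` (empty when `z` lies on an edge). -/
def face (z : ℂ) : Set ℂ := connectedComponentIn G.skeletonᶜ z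

/-! ### Dimer configurations and dimer measures -/

/-- `M` is a dimer configuration (perfect matching) of the subgraph induced by `D`. -/
def IsDimer (D : Set V) (M : G.Config) : Prop :=
  (∀ e ∈ M, ∀ v ∈ e.1, v ∈ D) ∧ ∀ v ∈ D, ∃! e : G.Edge, e ∈ M ∧ v ∈ e.1

/-- The probability measure on a finite set `S` of configurations that gives `M ∈ S` a mass
proportional to `wt M`. -/
noncomputable def boltzmann (S : Set G.Config) (wt : G.Config → ℝ) : Measure G.Config :=
  (ENNReal.ofReal (∑ᶠ M ∈ S, wt M))⁻¹ •
    Measure.sum fun M : S => ENNReal.ofReal (wt M.1) • Measure.dirac M.1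

/-- The dimer measure on the finite domain `D`: the mass of a dimer configuration is proportional
to the product of the weights of its edges. -/
noncomputable def dimerMeasure (D : Finset V) : Measure G.Config :=
  G.boltzmann {M | G.IsDimer (D : Set V) M} fun M => ∏ᶠ e ∈ M, G.weight e

/-- The edges contained in the closed ball of radius `R` around the origin. -/
def edgesInside (R : ℝ) : Set G.Edge := {e | G.edgeSegment e ⊆ Metric.closedBall 0 R}

/-- The dimer measure on the dimer configurations of the whole graph that agree with `m` outside
the ball of radius `R` around the origin. The weights of the edges outside the ball are common to
all these configurations and cancel in the normalization. -/
noncomputable def specification (R : ℝ) (m : G.Config) : Measure G.Config :=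
  G.boltzmann
    {M | G.IsDimer Set.univ M ∧ ∀ e, e ∉ G.edgesInside R → (e ∈ M ↔ e ∈ m)}
    fun M => ∏ᶠ e ∈ M ∩ G.edgesInside R, G.weight e

/-- The law of a dimer configuration on a random domain `D`: the average of the dimer measures. -/
noncomputable def randomDimerLaw {Ω : Type*} [MeasurableSpace Ω] (P : Measure Ω)
    (D : Ω → Finset V) : Measure G.Config :=
  P.bind fun ω => G.dimerMeasure (D ω)

/-! ### Height functions -/

/-- A reference flow: a unit flow out of every white vertex and into every black vertex. -/
def IsReferenceFlow (ref : G.Edge → ℝ) : Prop :=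
  ∀ v : V, ∑ᶠ e ∈ {e : G.Edge | v ∈ e.1}, ref e = 1

/-- The face of `z` is the one on the left of the segment from `u` to `v`. The face on the right
of this segment is the one on the left of the segment from `v` to `u`. -/
def OnLeft (u v : V) (z : ℂ) : Prop :=
  z ∉ G.skeleton ∧ ∀ᶠ t : ℝ in 𝓝[>] 0,
    (G.pos u + G.pos v) / 2 + t * Complex.I * (G.pos v - G.pos u) ∈ G.face z

open Classical in
/-- `h` is a height function of the configuration `M` on the domain `D` (seen as a function of the
points of the faces): it is constant on faces, and when one crosses an edge of the graph with an
endpoint in `D`, from the right to the left of its white-to-black orientation, it changes by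
`1 - ref e` if the edge is in `M` and by `- ref e` otherwise. -/
def IsHeight (ref : G.Edge → ℝ) (D : Set V) (M : G.Config) (h : ℂ → ℝ) : Prop :=
  (∀ z, ∀ z' ∈ G.face z, h z' = h z) ∧
  ∀ (a b : V) (hab : G.graph.Adj a b), a ∈ G.white → (a ∈ D ∨ b ∈ D) →
    ∀ z z', G.OnLeft a b z → G.OnLeft b a z' →
      h z - h z' = (if (⟨s(a, b), hab⟩ : G.Edge) ∈ M then 1 else 0) - ref ⟨s(a, b), hab⟩

/-- The face of `z` has a vertex of `D`: these are the faces on which heights on `D` live. -/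
def IsFaceOf (D : Set V) (z : ℂ) : Prop :=
  z ∉ G.skeleton ∧ ∃ v ∈ D, G.pos v ∈ closure (G.face z)

/-- The face of `z` is on the boundary of `D`: it has a vertex in `D` and a vertex outside `D`. -/
def IsBoundaryFace (D : Set V) (z : ℂ) : Prop :=
  G.IsFaceOf D z ∧ ∃ v ∉ D, G.pos v ∈ closure (G.face z)

/-- The faces of `z` and `z'` are the two sides of an edge with an endpoint in `D`. -/
def AdjacentFaces (D : Set V) (z z' : ℂ) : Prop :=
  ∃ u v, G.graph.Adj u v ∧ (u ∈ D ∨ v ∈ D) ∧ G.OnLeft u v z ∧ G.OnLeft v u z'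

/-- `h` chooses the height functions of all dimer configurations on `D`, with the additive
constants fixed on the boundary: every face of `D` is connected inside `D` to a boundary face
where the height does not depend on the configuration. -/
def IsNormalizedHeight (ref : G.Edge → ℝ) (D : Set V) (h : G.Config → ℂ → ℝ) : Prop :=
  (∀ M, G.IsDimer D M → G.IsHeight ref D M (h M)) ∧
  ∀ z, G.IsFaceOf D z → ∃ b, G.IsBoundaryFace D b ∧
    Relation.ReflTransGen (G.AdjacentFaces D) z b ∧
    ∀ M₁ M₂, G.IsDimer D M₁ → G.IsDimer D M₂ → h M₁ b = h M₂ b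

/-- For all configurations on `D` and on `D'`, the heights on the boundary of `D ∩ D'` differ by
at most `K`. -/
def BoundaryHeightsWithin (ref : G.Edge → ℝ) (D D' : Set V) (K : ℝ) : Prop :=
  ∃ h h' : G.Config → ℂ → ℝ, G.IsNormalizedHeight ref D h ∧ G.IsNormalizedHeight ref D' h' ∧
    ∀ M M', G.IsDimer D M → G.IsDimer D' M' →
      ∀ z, G.IsBoundaryFace (D ∩ D') z → |h' M' z - h M z| ≤ K

/-- The spread-out property. A height function on the whole plane is unique up to an additive
constant, which is fixed at a point `z` outside the ball; `H 0 - H z` is then the height at `0`. -/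
def SpreadOut (ref : G.Edge → ℝ) (μ : Measure G.Config) : Prop :=
  ∀ ε : ℝ, 0 < ε → ∃ R : ℝ, 0 < R ∧
    1 - ε < μ.real {m | ∀ z, z ∉ G.skeleton → R < ‖z‖ → ∀ x : ℝ,
      (G.specification R m).real {M | ∀ H, G.IsHeight ref Set.univ M H →
        H 0 - H z ∈ Set.Ioo x (x + 1)} ≤ ε}

/-! ### Local convergence -/

/-- `exp (- max R)` over the radii `R` such that the two configurations, as subsets of the plane,
agree on the ball of radius `R` around the origin (and `0` if they agree on all balls). -/
noncomputable def localDist (M N : G.Config) : ℝ :=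
  sInf {δ | ∃ R : ℝ, 0 ≤ R ∧ δ = Real.exp (-R) ∧
    G.drawing M ∩ Metric.ball 0 R = G.drawing N ∩ Metric.ball 0 R}

/-- Local convergence around the origin: convergence in law for the local distance. -/
def LocallyConverges (ν : ℕ → Measure G.Config) (μ : Measure G.Config) : Prop :=
  ∀ F : G.Config → ℝ, (∃ C, ∀ M, |F M| ≤ C) →
    (∀ M, ∀ ε > 0, ∃ δ > 0, ∀ N, G.localDist M N < δ → |F N - F M| < ε) →
    Tendsto (fun n => ∫ M, F M ∂(ν n)) atTop (𝓝 (∫ M, F M ∂μ))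

end PlaneBipartiteGraph

/-!
Sample independent configurations on `D` and `D'` and call gap the difference of their heights.
Explore the faces, starting from the boundary of `D ∩ D'`, as long as the gap is at most `K` in
absolute value, and exchange the two configurations on the edges enclosed by the exploration. The
exchange preserves the product of the two weights, and it is an involution provided that it changes
no height outside the enclosed region. This is a reflection argument: if `a` and `a'` are the
changes of the two heights, then `a' - a + 2 * gap` is constant on each enclosed component, whereas
`|a' - a| ≤ 2 * K` and `K < |gap| ≤ K + 1` along its rim. Hence the gap, whose increments are
integers, takes only one value there, and the heights on the two sides of the component are changed
equally.

Where the origin is deep inside the enclosed region, the exchange swaps the local pictures of the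
two configurations. By the Markov property and the spread-out property of the limit, the height at
the origin of the configuration on `D` is unlikely to be within a given distance of that on `D'`,
so the gap at the origin is large with high probability and the two local laws are close.
-/

namespace PlaneBipartiteGraph

variable {V : Type*} {G : PlaneBipartiteGraph V}

/-! ### Planar geometry of edges and faces -/

lemma edgeSegment_mk {u v : V} (h : G.graph.Adj u v) :
    G.edgeSegment ⟨s(u, v), h⟩ = segment ℝ (G.pos u) (G.pos v) := by
  ext z
  constructor
  · rintro ⟨u', v', he, hz⟩
    rcases Sym2.eq_iff.1 he with ⟨rfl, rfl⟩ | ⟨rfl, rfl⟩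
    · exact hz
    · rwa [segment_symm]
  · exact fun hz => ⟨u, v, rfl, hz⟩

lemma exists_adj_eq_mk (e : G.Edge) : ∃ u v, ∃ h : G.graph.Adj u v, e = ⟨s(u, v), h⟩ := by
  obtain ⟨e, he⟩ := e
  induction e using Sym2.ind with
  | _ u v => exact ⟨u, v, he, rfl⟩

lemma pos_mem_edgeSegment {e : G.Edge} {v : V} (hv : v ∈ e.1) : G.pos v ∈ G.edgeSegment e := by
  obtain ⟨w, hw⟩ := hv
  exact ⟨v, w, hw, left_mem_segment _ _ _⟩

lemma isClosed_edgeSegment (e : G.Edge) : IsClosed (G.edgeSegment e) := by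
  obtain ⟨u, v, h, rfl⟩ := exists_adj_eq_mk e
  rw [edgeSegment_mk, segment_eq_image']
  exact (isCompact_Icc.image (by fun_prop)).isClosed

variable (G) in
/-- The edges that meet the closed disc of radius `R` around the origin. The events and observables
of the local topology are those which depend on such a finite set of edges only. -/
def edgesMeeting (R : ℝ) : Set G.Edge :=
  {e | (G.edgeSegment e ∩ Metric.closedBall 0 R).Nonempty}

lemma finite_edgesMeeting (R : ℝ) : (G.edgesMeeting R).Finite := by
  refine (G.finite_edges R).subset ?_
  rintro e ⟨z, ⟨u, v, he, hz⟩, hzR⟩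
  exact ⟨u, v, he, z, hz, hzR⟩

lemma edgesMeeting_mono {R R' : ℝ} (h : R ≤ R') : G.edgesMeeting R ⊆ G.edgesMeeting R' :=
  fun _ he => he.mono (Set.inter_subset_inter_right _ (Metric.closedBall_subset_closedBall h))

lemma mem_edgesMeeting_of_mem {e : G.Edge} {v : V} (hv : v ∈ e.1) {R : ℝ} (hR : ‖G.pos v‖ ≤ R) :
    e ∈ G.edgesMeeting R :=
  ⟨_, pos_mem_edgeSegment hv, mem_closedBall_zero_iff.2 hR⟩

lemma locallyFinite_edgeSegment : LocallyFinite G.edgeSegment := fun x =>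
  ⟨Metric.closedBall 0 (‖x‖ + 1),
    mem_of_superset (Metric.isOpen_ball.mem_nhds (by simp)) Metric.ball_subset_closedBall,
    finite_edgesMeeting _⟩

lemma isClosed_drawing (M : G.Config) : IsClosed (G.drawing M) := by
  rw [drawing, Set.biUnion_eq_iUnion]
  exact (locallyFinite_edgeSegment.comp_injective Subtype.val_injective).isClosed_iUnion
    fun e => isClosed_edgeSegment e.1

lemma isClosed_skeleton : IsClosed G.skeleton := isClosed_drawing _

lemma isOpen_face (z : ℂ) : IsOpen (G.face z) :=
  isClosed_skeleton.isOpen_compl.connectedComponentIn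

lemma mem_face_self {z : ℂ} (hz : z ∉ G.skeleton) : z ∈ G.face z := mem_connectedComponentIn hz

lemma notMem_skeleton_of_mem_face {z z' : ℂ} (h : z' ∈ G.face z) : z' ∉ G.skeleton :=
  connectedComponentIn_subset _ _ h

lemma face_eq_of_mem {z z' : ℂ} (h : z' ∈ G.face z) : G.face z' = G.face z :=
  (connectedComponentIn_eq h).symm

lemma mem_face_symm {z z' : ℂ} (h : z' ∈ G.face z) : z ∈ G.face z' := by
  rw [face_eq_of_mem h]
  exact mem_face_self (connectedComponentIn_nonempty_iff.1 ⟨z', h⟩)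

lemma subset_face {s : Set ℂ} {y z : ℂ} (hs : IsPreconnected s) (hsk : Disjoint s G.skeleton)
    (hy : y ∈ s) (hyz : y ∈ G.face z) : s ⊆ G.face z := by
  rw [← face_eq_of_mem hyz]
  exact hs.subset_connectedComponentIn hy hsk.subset_compl_right

lemma OnLeft.congr {u v : V} {z z' : ℂ} (h : G.OnLeft u v z) (hz : z' ∈ G.face z) :
    G.OnLeft u v z' := by
  refine ⟨notMem_skeleton_of_mem_face hz, ?_⟩
  rw [face_eq_of_mem hz]
  exact h.2

variable (G) in
/-- The affine coordinate of the plane in which the edge from `u` to `v` is the real interval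
`[0, 1]` and its left side is the upper half plane. -/
noncomputable def chart (u v : V) (w : ℂ) : ℂ := G.pos u + w * (G.pos v - G.pos u)

lemma continuous_chart (u v : V) : Continuous (G.chart u v) := by
  unfold chart
  fun_prop

lemma chart_zero (u v : V) : G.chart u v 0 = G.pos u := by simp [chart]

lemma chart_one (u v : V) : G.chart u v 1 = G.pos v := by simp [chart]

lemma chart_swap (u v : V) (w : ℂ) : G.chart v u w = G.chart u v (1 - w) := by
  unfold chart
  ring

lemma midpoint_add_eq_chart (u v : V) (t : ℝ) :
    (G.pos u + G.pos v) / 2 + t * Complex.I * (G.pos v - G.pos u) =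
      G.chart u v ((1 / 2 : ℝ) + t * Complex.I) := by
  unfold chart
  push_cast
  ring

lemma pos_sub_pos_ne_zero {u v : V} (h : G.graph.Adj u v) : G.pos v - G.pos u ≠ 0 :=
  sub_ne_zero.2 fun h' => h.ne (G.pos_injective h').symm

lemma chart_injective {u v : V} (h : G.graph.Adj u v) : Function.Injective (G.chart u v) := by
  intro a b hab
  simpa [chart, pos_sub_pos_ne_zero h] using hab

lemma mem_segment_iff_chart {u v : V} {z : ℂ} :
    z ∈ segment ℝ (G.pos u) (G.pos v) ↔ ∃ s : ℝ, s ∈ Set.Icc (0 : ℝ) 1 ∧ z = G.chart u v s := by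
  rw [segment_eq_image']
  constructor
  · rintro ⟨s, hs, rfl⟩
    exact ⟨s, hs, by simp [chart]⟩
  · rintro ⟨s, hs, rfl⟩
    exact ⟨s, hs, by simp [chart]⟩

lemma eq_mk_of_chart_mem_edgeSegment {u v : V} (h : G.graph.Adj u v) {s : ℝ}
    (hs : s ∈ Set.Ioo (0 : ℝ) 1) {e : G.Edge} (he : G.chart u v s ∈ G.edgeSegment e) :
    e = ⟨s(u, v), h⟩ := by
  obtain ⟨u', v', h', rfl⟩ := exists_adj_eq_mk e
  rw [edgeSegment_mk] at he
  by_contra hne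
  have hne' : s(u, v) ≠ s(u', v') := fun heq => hne (Subtype.ext heq.symm)
  obtain ⟨x, hx, hxe, -⟩ := G.noncrossing u v u' v' h h' hne' _
    ⟨mem_segment_iff_chart.2 ⟨s, ⟨hs.1.le, hs.2.le⟩, rfl⟩, he⟩
  rcases Sym2.mem_iff.1 hxe with rfl | rfl
  · rw [← chart_zero x v] at hx
    exact hs.1.ne (by exact_mod_cast chart_injective h hx)
  · rw [← chart_one u x] at hx
    exact hs.2.ne' (by exact_mod_cast chart_injective h hx)

lemma exists_thickening_chart {u v : V} (h : G.graph.Adj u v) {K : Set ℝ} (hK : IsCompact K)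
    (hK1 : K ⊆ Set.Ioo 0 1) : ∃ δ > 0, ∀ w ∈ Metric.thickening δ ((↑) '' K : Set ℂ),
      G.chart u v w ∈ G.skeleton → w.im = 0 := by
  have hother := isClosed_drawing {e : G.Edge | e ≠ ⟨s(u, v), h⟩}
  obtain ⟨δ, hδ, hsub⟩ := (hK.image Complex.continuous_ofReal).exists_thickening_subset_open
    (hother.isOpen_compl.preimage (continuous_chart u v)) (by
      rintro _ ⟨s, hs, rfl⟩ hmem
      obtain ⟨e, he, hse⟩ := Set.mem_iUnion₂.1 hmem
      exact he (eq_mk_of_chart_mem_edgeSegment h (hK1 hs) hse))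
  refine ⟨δ, hδ, fun w hw hsk => ?_⟩
  obtain ⟨e, -, hse⟩ := Set.mem_iUnion₂.1 hsk
  obtain rfl : e = ⟨s(u, v), h⟩ := by
    by_contra hne
    exact hsub hw (Set.mem_biUnion hne hse)
  rw [edgeSegment_mk] at hse
  obtain ⟨s, -, hs⟩ := mem_segment_iff_chart.1 hse
  rw [chart_injective h hs, Complex.ofReal_im]

variable (G) in
/-- The points to the left of the edge from `u` to `v` at distance less than `δ` (in the coordinate
`chart`) from the part of the edge parametrized by `K`. -/
def leftCollar (u v : V) (K : Set ℝ) (δ : ℝ) : Set ℂ :=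
  G.chart u v '' (Metric.thickening δ ((↑) '' K : Set ℂ) ∩ {w : ℂ | 0 < w.im})

lemma isPreconnected_leftCollar (u v : V) {K : Set ℝ} (hK : Convex ℝ K) (δ : ℝ) :
    IsPreconnected (G.leftCollar u v K δ) := by
  have hK' : Convex ℝ ((↑) '' K : Set ℂ) :=
    hK.is_linear_image Complex.ofRealLI.toLinearMap.isLinear
  exact ((hK'.thickening δ).inter (convex_halfSpace_im_gt 0)).isPreconnected.image _
    (continuous_chart u v).continuousOn

lemma exists_disjoint_leftCollar_skeleton {u v : V} (h : G.graph.Adj u v) {K : Set ℝ}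
    (hK : IsCompact K) (hK1 : K ⊆ Set.Ioo 0 1) :
    ∃ δ > 0, Disjoint (G.leftCollar u v K δ) G.skeleton := by
  obtain ⟨δ, hδ, hsk⟩ := exists_thickening_chart h hK hK1
  refine ⟨δ, hδ, Set.disjoint_left.2 ?_⟩
  rintro _ ⟨w, ⟨hw, hwim⟩, rfl⟩ hmem
  exact hwim.ne' (hsk w hw hmem)

lemma chart_mem_leftCollar (u v : V) {K : Set ℝ} {s δ : ℝ} (hs : s ∈ K) {w : ℂ}
    (hw : ‖w - s‖ < δ) (hwim : 0 < w.im) : G.chart u v w ∈ G.leftCollar u v K δ :=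
  Set.mem_image_of_mem _
    ⟨Metric.mem_thickening_iff.2 ⟨s, ⟨s, hs, rfl⟩, by rwa [dist_eq_norm]⟩, hwim⟩

lemma chart_add_mul_I_mem_leftCollar (u v : V) {K : Set ℝ} {s t δ : ℝ} (hs : s ∈ K)
    (ht : t ∈ Set.Ioo 0 δ) : G.chart u v (s + t * Complex.I) ∈ G.leftCollar u v K δ :=
  chart_mem_leftCollar u v hs (by simpa [abs_of_pos ht.1] using ht.2) (by simpa using ht.1)

lemma exists_onLeft {u v : V} (h : G.graph.Adj u v) : ∃ z, G.OnLeft u v z := by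
  obtain ⟨δ, hδ, hsk⟩ := exists_disjoint_leftCollar_skeleton h
    (isCompact_singleton (x := (1 / 2 : ℝ))) (Set.singleton_subset_iff.2 (by norm_num))
  have hmem : ∀ t ∈ Set.Ioo 0 δ,
      G.chart u v ((1 / 2 : ℝ) + t * Complex.I) ∈ G.leftCollar u v {1 / 2} δ :=
    fun t ht => chart_add_mul_I_mem_leftCollar u v rfl ht
  have hz := hmem (δ / 2) ⟨by linarith, by linarith⟩
  have hzsk := hsk.notMem_of_mem_left hz
  refine ⟨_, hzsk, ?_⟩
  filter_upwards [Ioo_mem_nhdsGT hδ] with t ht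
  rw [midpoint_add_eq_chart]
  exact subset_face (isPreconnected_leftCollar u v (convex_singleton _) δ) hsk hz
    (mem_face_self hzsk) (hmem t ht)

lemma OnLeft.exists_upperHalfDisc_subset {u v : V} (h : G.graph.Adj u v) {z : ℂ}
    (hz : G.OnLeft u v z) {s : ℝ} (hs : s ∈ Set.Ioo (0 : ℝ) 1) :
    ∃ δ > 0, ∀ w : ℂ, ‖w - s‖ < δ → 0 < w.im → G.chart u v w ∈ G.face z := by
  have hK1 : Set.uIcc s (1 / 2) ⊆ Set.Ioo (0 : ℝ) 1 :=
    Set.ordConnected_Ioo.uIcc_subset hs (by norm_num)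
  obtain ⟨δ, hδ, hsk⟩ := exists_disjoint_leftCollar_skeleton h isCompact_uIcc hK1
  refine ⟨δ, hδ, fun w hw hwim => ?_⟩
  obtain ⟨t, htz, ht⟩ := (hz.2.and (Ioo_mem_nhdsGT hδ)).exists
  rw [midpoint_add_eq_chart] at htz
  exact subset_face (isPreconnected_leftCollar u v (convex_uIcc s (1 / 2)) δ) hsk
    (chart_add_mul_I_mem_leftCollar u v Set.right_mem_uIcc ht) htz
    (chart_mem_leftCollar u v Set.left_mem_uIcc hw hwim)

lemma OnLeft.exists_lowerHalfDisc_subset {u v : V} (h : G.graph.Adj u v) {z : ℂ}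
    (hz : G.OnLeft v u z) {s : ℝ} (hs : s ∈ Set.Ioo (0 : ℝ) 1) :
    ∃ δ > 0, ∀ w : ℂ, ‖w - s‖ < δ → w.im < 0 → G.chart u v w ∈ G.face z := by
  obtain ⟨δ, hδ, hface⟩ := hz.exists_upperHalfDisc_subset h.symm (s := 1 - s)
    ⟨by linarith [hs.2], by linarith [hs.1]⟩
  refine ⟨δ, hδ, fun w hw hwim => ?_⟩
  have hdist : ‖1 - w - ((1 - s : ℝ) : ℂ)‖ < δ := by
    rwa [Complex.ofReal_sub, Complex.ofReal_one, sub_sub_sub_cancel_left, norm_sub_rev]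
  have hmem := hface (1 - w) hdist (by simpa using hwim)
  rwa [chart_swap, sub_sub_cancel] at hmem

lemma OnLeft.segment_subset {u v : V} (h : G.graph.Adj u v) {z : ℂ} (hz : G.OnLeft u v z) :
    segment ℝ (G.pos u) (G.pos v) ⊆ closure (G.face z) := by
  refine segment_subset_closure_openSegment.trans (closure_minimal ?_ isClosed_closure)
  rw [openSegment_eq_image']
  rintro _ ⟨s, hs, rfl⟩
  obtain ⟨δ, hδ, hface⟩ := hz.exists_upperHalfDisc_subset h hs
  have hlim : Tendsto (fun t : ℝ => G.chart u v (s + t * Complex.I)) (𝓝[>] 0)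
      (𝓝 (G.pos u + s • (G.pos v - G.pos u))) := by
    have hcont : Continuous fun t : ℝ => G.chart u v (s + t * Complex.I) :=
      (continuous_chart u v).comp (by fun_prop)
    simpa [chart] using (hcont.tendsto 0).mono_left nhdsWithin_le_nhds
  refine mem_closure_of_tendsto hlim ?_
  filter_upwards [Ioo_mem_nhdsGT hδ] with t ht
  exact hface _ (by simpa [abs_of_pos ht.1] using ht.2) (by simpa using ht.1)

lemma OnLeft.pos_left_mem_closure {u v : V} (h : G.graph.Adj u v) {z : ℂ} (hz : G.OnLeft u v z) :
    G.pos u ∈ closure (G.face z) := hz.segment_subset h (left_mem_segment _ _ _)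

lemma OnLeft.pos_right_mem_closure {u v : V} (h : G.graph.Adj u v) {z : ℂ} (hz : G.OnLeft u v z) :
    G.pos v ∈ closure (G.face z) := hz.segment_subset h (right_mem_segment _ _ _)

lemma dense_compl_skeleton : Dense G.skeletonᶜ := by
  intro z
  by_cases hz : z ∈ G.skeleton
  · obtain ⟨e, -, hze⟩ := Set.mem_iUnion₂.1 hz
    obtain ⟨u, v, h, rfl⟩ := exists_adj_eq_mk e
    rw [edgeSegment_mk] at hze
    obtain ⟨y, hy⟩ := exists_onLeft h
    exact closure_mono (fun _ => notMem_skeleton_of_mem_face) (hy.segment_subset h hze)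
  · exact subset_closure hz

/-! ### Propagation of face properties across edges -/

lemma eq_of_eventuallyConst_nhdsWithin {X α : Type*} [TopologicalSpace X] {s U : Set X}
    (hs : Dense s) (hU : IsPreconnected U) {f : X → α} (hf : ∀ p ∈ U, EventuallyConst f (𝓝[s] p))
    {x y : X} (hx : x ∈ U) (hy : y ∈ U) (hxs : x ∈ s) (hys : y ∈ s) : f x = f y := by
  have hopen (q : α → Prop) : IsOpen {p | ∀ᶠ z in 𝓝[s] p, q (f z)} :=
    isOpen_iff_mem_nhds.2 fun _ hp => eventually_nhds_nhdsWithin.2 hp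
  have hcover (q : α → Prop) {p : X} (hp : p ∈ U) :
      (∀ᶠ z in 𝓝[s] p, q (f z)) ∨ ∀ᶠ z in 𝓝[s] p, ¬ q (f z) :=
    eventuallyConst_pred.1 ((hf p hp).comp q)
  have hself (q : α → Prop) {p : X} (hp : p ∈ U) (hps : p ∈ s) (hq : q (f p)) :
      ∀ᶠ z in 𝓝[s] p, q (f z) :=
    (hcover q hp).resolve_right fun h => h.self_of_nhdsWithin hps hq
  by_contra hne
  obtain ⟨p, -, (hpx : ∀ᶠ z in 𝓝[s] p, f z = f x), (hpy : ∀ᶠ z in 𝓝[s] p, f z ≠ f x)⟩ :=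
    hU _ _ (hopen (· = f x)) (hopen (· ≠ f x))
      (fun p hp => hcover (· = f x) hp) ⟨x, hx, hself (· = f x) hx hxs rfl⟩
      ⟨y, hy, hself (· ≠ f x) hy hys fun h => hne h.symm⟩
  have := mem_closure_iff_nhdsWithin_neBot.1 (hs p)
  obtain ⟨z, hz, hz'⟩ := (hpx.and hpy).exists
  exact hz' hz

/-- `f` is a function of the face: it is constant on every face. -/
def FaceConst {α : Type*} (G : PlaneBipartiteGraph V) (f : ℂ → α) : Prop :=
  ∀ z, ∀ z' ∈ G.face z, f z' = f z

/-- `f` takes the same value on the two sides of the edge from `u` to `v`. -/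
def SameAcross {α : Type*} (G : PlaneBipartiteGraph V) (f : ℂ → α) (u v : V) : Prop :=
  ∀ z z', G.OnLeft u v z → G.OnLeft v u z' → f z = f z'

section FaceConst

variable {α : Type*} {f : ℂ → α}

lemma SameAcross.symm {u v : V} (h : G.SameAcross f u v) : G.SameAcross f v u :=
  fun z z' hz hz' => (h z' z hz' hz).symm

lemma map_nhds_chart {u v : V} (h : G.graph.Adj u v) (w : ℂ) :
    map (G.chart u v) (𝓝 w) = 𝓝 (G.chart u v w) :=
  ((Homeomorph.mulRight₀ _ (pos_sub_pos_ne_zero h)).trans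
    (Homeomorph.addLeft (G.pos u))).map_nhds_eq w

lemma FaceConst.eventuallyConst_chart (hf : G.FaceConst f) {u v : V} (h : G.graph.Adj u v)
    (hc : G.SameAcross f u v) {s : ℝ} (hs : s ∈ Set.Ioo (0 : ℝ) 1) :
    EventuallyConst f (𝓝[G.skeletonᶜ] (G.chart u v s)) := by
  obtain ⟨l, hl⟩ := exists_onLeft h
  obtain ⟨r, hr⟩ := exists_onLeft h.symm
  obtain ⟨δ₁, hδ₁, hupper⟩ := hl.exists_upperHalfDisc_subset h hs
  obtain ⟨δ₂, hδ₂, hlower⟩ := hr.exists_lowerHalfDisc_subset h hs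
  have hre : ∀ᶠ w : ℂ in 𝓝 (s : ℂ), w.re ∈ Set.Ioo (0 : ℝ) 1 :=
    (isOpen_Ioo.preimage Complex.continuous_re).mem_nhds hs
  refine (EventuallyConst.const (f l)).congr (EventuallyEq.symm ?_)
  change ∀ᶠ z in 𝓝[G.skeletonᶜ] (G.chart u v s), f z = f l
  rw [eventually_nhdsWithin_iff, ← map_nhds_chart h, eventually_map]
  filter_upwards [Metric.ball_mem_nhds _ hδ₁, Metric.ball_mem_nhds _ hδ₂, hre]
    with w hw₁ hw₂ hwre hsk
  rw [mem_ball_iff_norm] at hw₁ hw₂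
  rcases lt_trichotomy w.im 0 with him | him | him
  · exact (hf r _ (hlower w hw₂ him)).trans (hc l r hl hr).symm
  · have hwseg : G.chart u v w ∈ segment ℝ (G.pos u) (G.pos v) :=
      mem_segment_iff_chart.2 ⟨w.re, ⟨hwre.1.le, hwre.2.le⟩, by
        rw [show (w.re : ℂ) = w from Complex.ext rfl him.symm]⟩
    rw [← edgeSegment_mk h] at hwseg
    exact (hsk (Set.mem_biUnion (Set.mem_univ _) hwseg)).elim
  · exact hf l _ (hupper w hw₁ him)

lemma FaceConst.eventuallyConst (hf : G.FaceConst f) {p : ℂ} (hp : ∀ x, G.pos x ≠ p)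
    (hc : ∀ u v, G.graph.Adj u v → p ∈ segment ℝ (G.pos u) (G.pos v) → G.SameAcross f u v) :
    EventuallyConst f (𝓝[G.skeletonᶜ] p) := by
  by_cases hps : p ∈ G.skeleton
  · obtain ⟨e, -, he⟩ := Set.mem_iUnion₂.1 hps
    obtain ⟨u, v, h, rfl⟩ := exists_adj_eq_mk e
    rw [edgeSegment_mk] at he
    obtain ⟨s, hs, rfl⟩ := mem_segment_iff_chart.1 he
    have hs0 : s ≠ 0 := by
      rintro rfl
      exact hp u (by simp [chart_zero])
    have hs1 : s ≠ 1 := by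
      rintro rfl
      exact hp v (by simp [chart_one])
    exact hf.eventuallyConst_chart h (hc u v h he) ⟨hs.1.lt_of_ne' hs0, hs.2.lt_of_ne hs1⟩
  · refine (EventuallyConst.const (f p)).congr (EventuallyEq.symm ?_)
    filter_upwards [mem_nhdsWithin_of_mem_nhds ((isOpen_face p).mem_nhds (mem_face_self hps))]
      with z hz using hf p z hz

lemma FaceConst.eq_of_forall_pos_notMem (hf : G.FaceConst f) {U : Set ℂ}
    (hU : IsPreconnected U) (hv : ∀ x, G.pos x ∉ U)
    (hc : ∀ u v, G.graph.Adj u v → (segment ℝ (G.pos u) (G.pos v) ∩ U).Nonempty →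
      G.SameAcross f u v) {z z' : ℂ} (hz : z ∈ U) (hz' : z' ∈ U)
    (hzs : z ∉ G.skeleton) (hzs' : z' ∉ G.skeleton) : f z = f z' :=
  eq_of_eventuallyConst_nhdsWithin dense_compl_skeleton hU
    (fun p hp => hf.eventuallyConst (fun x hx => hv x (hx ▸ hp))
      fun u v huv hseg => hc u v huv ⟨p, hseg, hp⟩) hz hz' hzs hzs'

lemma exists_ball_inter_segment_nonempty_imp (x : V) :
    ∃ ρ > 0, (∀ y, G.pos y ∈ Metric.ball (G.pos x) ρ → y = x) ∧
    ∀ u v, G.graph.Adj u v → (segment ℝ (G.pos u) (G.pos v) ∩ Metric.ball (G.pos x) ρ).Nonempty →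
      u = x ∨ v = x := by
  have hedges : G.pos x ∉ G.drawing {e | x ∉ e.1} := by
    intro hmem
    obtain ⟨e, he, hxe⟩ := Set.mem_iUnion₂.1 hmem
    obtain ⟨u, v, h, rfl⟩ := exists_adj_eq_mk e
    rw [edgeSegment_mk] at hxe
    exact he (G.no_vertex_inside u v x h hxe)
  have hvertices : G.pos x ∉ G.pos '' {y | ‖G.pos y‖ ≤ ‖G.pos x‖ + 1 ∧ y ≠ x} := by
    rintro ⟨y, hy, hyx⟩
    exact hy.2 (G.pos_injective hyx)
  obtain ⟨ρ₁, hρ₁, hball₁⟩ := Metric.isOpen_iff.1 (isClosed_drawing _).isOpen_compl _ hedges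
  obtain ⟨ρ₂, hρ₂, hball₂⟩ := Metric.isOpen_iff.1
    (((G.finite_vertices _).subset fun y hy => hy.1).image _).isClosed.isOpen_compl _ hvertices
  refine ⟨min ρ₁ (min ρ₂ 1), by simp [hρ₁, hρ₂], fun y hy => ?_, fun u v h => ?_⟩
  · by_contra hne
    simp only [Metric.mem_ball, lt_min_iff] at hy
    refine hball₂ (Metric.mem_ball.2 hy.2.1) ⟨y, ⟨?_, hne⟩, rfl⟩
    have hnorm := norm_le_norm_add_norm_sub' (G.pos y) (G.pos x)
    rw [← dist_eq_norm] at hnorm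
    linarith [hy.2.2]
  · rintro ⟨z, hz, hzb⟩
    by_contra! hne
    rw [Metric.mem_ball, lt_min_iff] at hzb
    rw [← edgeSegment_mk h] at hz
    refine hball₁ (Metric.mem_ball.2 hzb.1) (Set.mem_biUnion ?_ hz)
    exact fun hx => (Sym2.mem_iff.1 hx).elim (fun h => hne.1 h.symm) fun h => hne.2 h.symm

lemma isPreconnected_setOf_norm_sub_mem {E : Type*} [NormedAddCommGroup E] [NormedSpace ℝ E]
    (hE : 1 < Module.rank ℝ E) (c : E) {I : Set ℝ} (hI : IsPreconnected I)
    (hI0 : I ⊆ Set.Ioi 0) : IsPreconnected {z : E | ‖z - c‖ ∈ I} := by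
  convert (hI.prod (isPreconnected_sphere hE 0 1)).image (fun q : ℝ × E => c + q.1 • q.2)
    (by fun_prop)
  ext z
  constructor
  · intro hz
    have hz0 : 0 < ‖z - c‖ := hI0 hz
    refine ⟨(‖z - c‖, ‖z - c‖⁻¹ • (z - c)), ⟨hz, ?_⟩, ?_⟩
    · simp [norm_smul, hz0.ne']
    · simp [smul_smul, hz0.ne']
  · rintro ⟨⟨r, y⟩, ⟨hr, hy⟩, rfl⟩
    have hr0 : 0 < r := hI0 hr
    have hy1 : ‖y‖ = 1 := mem_sphere_zero_iff_norm.1 hy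
    simpa [norm_smul, abs_of_pos hr0, hy1] using hr

lemma FaceConst.eventuallyConst_pos (hf : G.FaceConst f) {x : V} {U : Set ℂ}
    (hU : U ∈ 𝓝 (G.pos x))
    (hc : ∀ u v, G.graph.Adj u v → (segment ℝ (G.pos u) (G.pos v) ∩ U).Nonempty →
      G.SameAcross f u v) : EventuallyConst f (𝓝[G.skeletonᶜ] (G.pos x)) := by
  obtain ⟨ρ, hρ, hρv, -⟩ := exists_ball_inter_segment_nonempty_imp (G := G) x
  obtain ⟨ρ', hρ', hsub⟩ := Metric.mem_nhds_iff.1 hU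
  have hpunctured : IsPreconnected {z | ‖z - G.pos x‖ ∈ Set.Ioo 0 (min ρ ρ')} :=
    isPreconnected_setOf_norm_sub_mem (by simp [Complex.rank_real_complex]) _ isPreconnected_Ioo
      fun r hr => hr.1
  by_cases hx : G.pos x ∈ G.skeleton
  · refine ((Metric.nhds_basis_ball.inf_principal _).eventuallyConst_iff).2
      ⟨min ρ ρ', lt_min hρ hρ', fun y hy y' hy' => ?_⟩
    have hmem : ∀ z ∈ Metric.ball (G.pos x) (min ρ ρ') ∩ G.skeletonᶜ,
        ‖z - G.pos x‖ ∈ Set.Ioo 0 (min ρ ρ') := fun z hz =>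
      ⟨norm_pos_iff.2 (sub_ne_zero.2 fun h => hz.2 (h ▸ hx)), mem_ball_iff_norm.1 hz.1⟩
    refine hf.eq_of_forall_pos_notMem hpunctured (fun y hy => ?_) ?_ (hmem y hy) (hmem y' hy')
      hy.2 hy'.2
    · have hyx := hρv y (mem_ball_iff_norm.2 (hy.2.trans_le (min_le_left _ _)))
      simp [hyx] at hy
    · rintro a b hab ⟨q, hq, hqU⟩
      exact hc a b hab ⟨q, hq, hsub (mem_ball_iff_norm.2 (hqU.2.trans_le (min_le_right _ _)))⟩
  · refine (EventuallyConst.const (f (G.pos x))).congr (EventuallyEq.symm ?_)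
    filter_upwards [mem_nhdsWithin_of_mem_nhds ((isOpen_face _).mem_nhds (mem_face_self hx))]
      with z hz using hf _ z hz

lemma FaceConst.eq_of_isOpen (hf : G.FaceConst f) {U : Set ℂ}
    (hU : IsPreconnected U) (hUo : IsOpen U)
    (hc : ∀ u v, G.graph.Adj u v → (segment ℝ (G.pos u) (G.pos v) ∩ U).Nonempty →
      G.SameAcross f u v) {z z' : ℂ} (hz : z ∈ U) (hz' : z' ∈ U)
    (hzs : z ∉ G.skeleton) (hzs' : z' ∉ G.skeleton) : f z = f z' := by
  refine eq_of_eventuallyConst_nhdsWithin dense_compl_skeleton hU (fun p hp => ?_) hz hz' hzs hzs'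
  by_cases hvertex : ∃ x, G.pos x = p
  · obtain ⟨x, rfl⟩ := hvertex
    exact hf.eventuallyConst_pos (hUo.mem_nhds hp) hc
  · exact hf.eventuallyConst (not_exists.1 hvertex) fun u v huv hseg => hc u v huv ⟨p, hseg, hp⟩

end FaceConst

/-! ### Rotation around a vertex -/

lemma neg_exp_mul_I_mem_slitPlane {θ : ℝ} (hθ : θ ∈ Set.Ioo 0 (2 * Real.pi)) :
    -Complex.exp (θ * Complex.I) ∈ Complex.slitPlane := by
  have harg := Complex.arg_exp_mul_I (θ - Real.pi)
  rw [(toIocMod_eq_self _).2 ⟨by linarith [hθ.1], by linarith [hθ.2]⟩] at harg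
  have hexp : -Complex.exp (θ * Complex.I) = Complex.exp ((θ - Real.pi : ℝ) * Complex.I) := by
    rw [Complex.ofReal_sub, sub_mul, Complex.exp_sub, Complex.exp_pi_mul_I, div_neg, div_one]
  rw [hexp, Complex.mem_slitPlane_iff_arg, harg]
  exact ⟨by linarith [hθ.2], Complex.exp_ne_zero _⟩

lemma exists_eq_norm_mul_exp_of_neg_mem_slitPlane {q : ℂ} (hq : -q ∈ Complex.slitPlane) :
    ∃ ψ ∈ Set.Ioo 0 (2 * Real.pi), q = ‖q‖ * Complex.exp (ψ * Complex.I) := by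
  have hpi := (Complex.arg_le_pi (-q)).lt_of_ne (Complex.mem_slitPlane_iff_arg.1 hq).1
  refine ⟨(-q).arg + Real.pi, ⟨by linarith [Complex.neg_pi_lt_arg (-q)], by linarith⟩, ?_⟩
  have hpolar := Complex.norm_mul_exp_arg_mul_I (-q)
  rw [norm_neg] at hpolar
  rw [Complex.ofReal_add, add_mul, Complex.exp_add, Complex.exp_pi_mul_I, mul_neg_one, mul_neg,
    hpolar, neg_neg]

lemma neg_direction_div_direction_mem_slitPlane {x w w' : V} (h : G.graph.Adj x w)
    (h' : G.graph.Adj x w') (hne : w ≠ w') :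
    -((G.pos w' - G.pos x) / (G.pos w - G.pos x)) ∈ Complex.slitPlane := by
  have hd := pos_sub_pos_ne_zero h
  have hd' := pos_sub_pos_ne_zero h'
  set q := (G.pos w' - G.pos x) / (G.pos w - G.pos x) with hq
  by_contra hslit
  simp only [Complex.mem_slitPlane_iff, Complex.neg_re, Complex.neg_im, neg_ne_zero, not_or,
    not_lt, not_not, Left.neg_nonpos_iff] at hslit
  have hqre : q = q.re := Complex.ext rfl hslit.2
  have hw' : G.pos w' = G.chart x w q.re := by
    rw [← hqre, chart, hq, div_mul_cancel₀ _ hd, add_sub_cancel]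
  have hw : G.pos w = G.chart x w' (q.re⁻¹ : ℝ) := by
    rw [Complex.ofReal_inv, ← hqre, chart, hq, inv_div, div_mul_cancel₀ _ hd', add_sub_cancel]
  rcases le_total q.re 1 with h1 | h1
  · have hmem := G.no_vertex_inside x w w' h (mem_segment_iff_chart.2 ⟨_, ⟨hslit.1, h1⟩, hw'⟩)
    exact (Sym2.mem_iff.1 hmem).elim h'.ne' hne.symm
  · have hmem := G.no_vertex_inside x w' w h' (mem_segment_iff_chart.2
      ⟨_, ⟨inv_nonneg.2 hslit.1, inv_le_one_of_one_le₀ h1⟩, hw⟩)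
    exact (Sym2.mem_iff.1 hmem).elim h.ne' hne

variable (G) in
/-- The point with polar coordinates `(r, θ)` around `u`, where lengths are measured in units of
the edge from `u` to `v` and angles counterclockwise from this edge. -/
noncomputable def arc (u v : V) (r θ : ℝ) : ℂ := G.chart u v (r * Complex.exp (θ * Complex.I))

lemma continuous_arc (u v : V) (r : ℝ) : Continuous (G.arc u v r) :=
  (continuous_chart u v).comp (by fun_prop)

lemma norm_arc_sub_pos {u v : V} {r : ℝ} (hr : 0 ≤ r) (θ : ℝ) :
    ‖G.arc u v r θ - G.pos u‖ = r * ‖G.pos v - G.pos u‖ := by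
  simp [arc, chart, Complex.norm_exp_ofReal_mul_I, abs_of_nonneg hr]

lemma arc_add_two_pi (u v : V) (r θ : ℝ) : G.arc u v r (θ + 2 * Real.pi) = G.arc u v r θ := by
  rw [arc, Complex.ofReal_add, add_mul, Complex.exp_add]
  push_cast
  rw [Complex.exp_two_pi_mul_I, mul_one, arc]

lemma exists_arc_eq_arc {x w w' : V} (h : G.graph.Adj x w) (h' : G.graph.Adj x w')
    (hne : w ≠ w') :
    ∃ ψ ∈ Set.Ioo 0 (2 * Real.pi), ∃ q > 0, ∀ r θ, G.arc x w r θ = G.arc x w' (r / q) (θ - ψ) := by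
  have hd := pos_sub_pos_ne_zero h
  obtain ⟨ψ, hψ, hq⟩ := exists_eq_norm_mul_exp_of_neg_mem_slitPlane
    (neg_direction_div_direction_mem_slitPlane h h' hne)
  have hq0 := norm_pos_iff.2 (div_ne_zero (pos_sub_pos_ne_zero h') hd)
  refine ⟨ψ, hψ, _, hq0, fun r θ => ?_⟩
  have hqC : ((‖(G.pos w' - G.pos x) / (G.pos w - G.pos x)‖ : ℝ) : ℂ) ≠ 0 := by
    exact_mod_cast hq0.ne'
  have hexp := Complex.exp_ne_zero (ψ * Complex.I)
  rw [div_eq_iff hd] at hq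
  generalize ‖(G.pos w' - G.pos x) / (G.pos w - G.pos x)‖ = q at hq hqC
  simp only [arc, chart, hq]
  push_cast
  rw [sub_mul, Complex.exp_sub]
  field_simp

lemma arc_notMem_segment {u v : V} (h : G.graph.Adj u v) {r θ : ℝ} (hr : 0 < r)
    (hθ : θ ∈ Set.Ioo 0 (2 * Real.pi)) : G.arc u v r θ ∉ segment ℝ (G.pos u) (G.pos v) := by
  intro hmem
  obtain ⟨s, hs, hseq⟩ := mem_segment_iff_chart.1 hmem
  have hrs : (r : ℂ) * Complex.exp (θ * Complex.I) = s := chart_injective h hseq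
  have hexp : -Complex.exp (θ * Complex.I) = ((-(s / r) : ℝ) : ℂ) := by
    have hr0 : (r : ℂ) ≠ 0 := by exact_mod_cast hr.ne'
    push_cast
    rw [← hrs, mul_div_cancel_left₀ _ hr0]
  have hslit := neg_exp_mul_I_mem_slitPlane hθ
  rw [hexp, Complex.ofReal_mem_slitPlane, neg_pos] at hslit
  exact hslit.not_ge (div_nonneg hs.1 hr.le)

lemma eventually_norm_mul_exp_sub_lt (r : ℝ) {δ : ℝ} (hδ : 0 < δ) :
    ∀ᶠ θ : ℝ in 𝓝 0, ‖(r : ℂ) * Complex.exp (θ * Complex.I) - r‖ < δ := by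
  have hcont : Continuous fun θ : ℝ => ‖(r : ℂ) * Complex.exp (θ * Complex.I) - r‖ := by fun_prop
  exact hcont.tendsto' 0 0 (by simp) |>.eventually (gt_mem_nhds hδ)

lemma OnLeft.eventually_arc_mem_face {u v : V} (h : G.graph.Adj u v) {z : ℂ}
    (hz : G.OnLeft u v z) {r : ℝ} (hr : r ∈ Set.Ioo (0 : ℝ) 1) :
    ∀ᶠ θ in 𝓝[>] 0, G.arc u v r θ ∈ G.face z := by
  obtain ⟨δ, hδ, hface⟩ := hz.exists_upperHalfDisc_subset h hr
  filter_upwards [nhdsWithin_le_nhds (eventually_norm_mul_exp_sub_lt r hδ),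
    Ioo_mem_nhdsGT Real.pi_pos] with θ hθ hθpi
  refine hface _ hθ ?_
  rw [Complex.im_ofReal_mul, Complex.exp_ofReal_mul_I_im]
  exact mul_pos hr.1 (Real.sin_pos_of_mem_Ioo hθpi)

lemma OnLeft.eventually_arc_mem_face_right {u v : V} (h : G.graph.Adj u v) {z : ℂ}
    (hz : G.OnLeft v u z) {r : ℝ} (hr : r ∈ Set.Ioo (0 : ℝ) 1) :
    ∀ᶠ θ in 𝓝[<] 0, G.arc u v r θ ∈ G.face z := by
  obtain ⟨δ, hδ, hface⟩ := hz.exists_lowerHalfDisc_subset h hr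
  filter_upwards [nhdsWithin_le_nhds (eventually_norm_mul_exp_sub_lt r hδ),
    Ioo_mem_nhdsLT (neg_lt_zero.2 Real.pi_pos)] with θ hθ hθpi
  refine hface _ hθ ?_
  rw [Complex.im_ofReal_mul, Complex.exp_ofReal_mul_I_im]
  exact mul_neg_of_pos_of_neg hr.1 (Real.sin_neg_of_neg_of_neg_pi_lt hθpi.2 hθpi.1)

lemma FaceConst.eventually_eq_on_arc {α : Type*} {f : ℂ → α} (hf : G.FaceConst f) {x w : V}
    (h : G.graph.Adj x w) :
    ∀ᶠ r : ℝ in 𝓝[>] 0, ∀ I : Set ℝ, IsPreconnected I →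
      (∀ v, G.graph.Adj x v → ∀ θ ∈ I, G.arc x w r θ ∈ segment ℝ (G.pos x) (G.pos v) →
        G.SameAcross f x v) →
      ∀ θ₁ ∈ I, ∀ θ₂ ∈ I, G.arc x w r θ₁ ∉ G.skeleton → G.arc x w r θ₂ ∉ G.skeleton →
        f (G.arc x w r θ₁) = f (G.arc x w r θ₂) := by
  obtain ⟨ρ, hρ, hρv, hρe⟩ := exists_ball_inter_segment_nonempty_imp (G := G) x
  have hd : 0 < ‖G.pos w - G.pos x‖ := norm_pos_iff.2 (pos_sub_pos_ne_zero h)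
  filter_upwards [Ioo_mem_nhdsGT (div_pos hρ hd)] with r ⟨hr, hrρ⟩ I hI hcross θ₁ hθ₁ θ₂ hθ₂
  have hball (θ : ℝ) : G.arc x w r θ ∈ Metric.ball (G.pos x) ρ := by
    rwa [mem_ball_iff_norm, norm_arc_sub_pos hr.le, ← lt_div_iff₀ hd]
  refine hf.eq_of_forall_pos_notMem (hI.image _ (continuous_arc x w r).continuousOn) ?_ ?_
    (Set.mem_image_of_mem _ hθ₁) (Set.mem_image_of_mem _ hθ₂)
  · rintro y ⟨θ, -, hy⟩
    have hnorm := norm_arc_sub_pos (G := G) (u := x) (v := w) hr.le θ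
    rw [hy, hρv y (hy ▸ hball θ), sub_self, norm_zero] at hnorm
    exact (mul_pos hr hd).ne hnorm
  · rintro u v huv ⟨_, hseg, θ, hθ, rfl⟩
    rcases hρe u v huv ⟨_, hseg, hball θ⟩ with rfl | rfl
    · exact hcross v huv θ hθ hseg
    · rw [segment_symm] at hseg
      exact (hcross u huv.symm θ hθ hseg).symm

lemma FaceConst.eq_of_rotate {α : Type*} {f : ℂ → α} (hf : G.FaceConst f) {x w w' : V}
    (h : G.graph.Adj x w) (h' : G.graph.Adj x w') (hne : w ≠ w')
    (hc : ∀ y, G.graph.Adj x y → y ≠ w → y ≠ w' → G.SameAcross f x y) {l r : ℂ}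
    (hl : G.OnLeft x w l) (hr : G.OnLeft w' x r) : f l = f r := by
  obtain ⟨ψ, hψ, q, hq, harc⟩ := exists_arc_eq_arc h h' hne
  obtain ⟨r₀, hconst, hr₀, hlt⟩ :=
    ((hf.eventually_eq_on_arc h).and (Ioo_mem_nhdsGT (lt_min one_pos hq))).exists
  obtain ⟨hr₁, hrq⟩ := lt_min_iff.1 hlt
  have hcross (v : V) (hv : G.graph.Adj x v) (θ : ℝ) (hθ : θ ∈ Set.Ioo 0 ψ)
      (hseg : G.arc x w r₀ θ ∈ segment ℝ (G.pos x) (G.pos v)) : G.SameAcross f x v := by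
    refine hc v hv ?_ ?_ <;> rintro rfl
    · exact arc_notMem_segment h hr₀ ⟨hθ.1, hθ.2.trans hψ.2⟩ hseg
    · rw [harc, ← arc_add_two_pi] at hseg
      exact arc_notMem_segment h' (div_pos hr₀ hq)
        ⟨by linarith [hθ.1, hψ.2], by linarith [hθ.2]⟩ hseg
  have hleft : ∀ᶠ θ in 𝓝[>] 0, G.arc x w r₀ θ ∈ G.face l :=
    hl.eventually_arc_mem_face h ⟨hr₀, hr₁⟩
  have hright : ∀ᶠ θ in 𝓝[<] ψ, G.arc x w r₀ θ ∈ G.face r := by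
    have hlim : Tendsto (· - ψ) (𝓝[<] ψ) (𝓝[<] 0) :=
      tendsto_nhdsWithin_iff.2 ⟨(continuous_sub_right ψ).tendsto' ψ 0 (sub_self ψ) |>.mono_left
        nhdsWithin_le_nhds, eventually_nhdsWithin_of_forall fun θ hθ => by simpa using hθ⟩
    simpa only [harc] using hlim.eventually
      (hr.eventually_arc_mem_face_right h' ⟨div_pos hr₀ hq, (div_lt_one hq).2 hrq⟩)
  obtain ⟨θ₁, hθ₁l, hθ₁⟩ := (hleft.and (Ioo_mem_nhdsGT hψ.1)).exists
  obtain ⟨θ₂, hθ₂r, hθ₂⟩ := (hright.and (Ioo_mem_nhdsLT hψ.1)).exists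
  rw [← hf l _ hθ₁l, ← hf r _ hθ₂r]
  exact hconst _ isPreconnected_Ioo hcross θ₁ hθ₁ θ₂ hθ₂
    (notMem_skeleton_of_mem_face hθ₁l) (notMem_skeleton_of_mem_face hθ₂r)

/-! ### Heights across edges -/

open Classical in
/-- The sign that turns the increment of a height along an edge oriented away from `u` into the
increment along its white-to-black orientation. -/
noncomputable def orientation (G : PlaneBipartiteGraph V) (u : V) : ℝ :=
  if u ∈ G.white then 1 else -1

lemma orientation_eq_one_or (u : V) : G.orientation u = 1 ∨ G.orientation u = -1 := by
  unfold orientation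
  split_ifs <;> simp

open Classical in
lemma indicator_one_apply (M : G.Config) (e : G.Edge) :
    M.indicator (1 : G.Edge → ℝ) e = if e ∈ M then 1 else 0 :=
  Set.indicator_apply M 1 e

lemma indicator_one_congr {M M' : G.Config} {e : G.Edge} (h : e ∈ M' ↔ e ∈ M) :
    M'.indicator (1 : G.Edge → ℝ) e = M.indicator 1 e := by
  by_cases he : e ∈ M
  · rw [Set.indicator_of_mem he, Set.indicator_of_mem (h.2 he)]
  · rw [Set.indicator_of_notMem he, Set.indicator_of_notMem (mt h.1 he)]

lemma exists_int_indicator_sub (M M' : G.Config) (e : G.Edge) :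
    ∃ k : ℤ, M'.indicator (1 : G.Edge → ℝ) e - M.indicator 1 e = k ∧ |(k : ℝ)| ≤ 1 := by
  rw [indicator_one_apply, indicator_one_apply]
  split_ifs
  exacts [⟨0, by simp⟩, ⟨1, by simp⟩, ⟨-1, by simp⟩, ⟨0, by simp⟩]

section IsHeight

variable {ref : G.Edge → ℝ} {D D' : Set V} {M M' : G.Config} {h h' : ℂ → ℝ} {u v : V} {z z' : ℂ}

lemma IsHeight.faceConst (hh : G.IsHeight ref D M h) : G.FaceConst h := hh.1

lemma IsHeight.sub_eq (hh : G.IsHeight ref D M h) (huv : G.graph.Adj u v) (hD : u ∈ D ∨ v ∈ D)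
    (hz : G.OnLeft u v z) (hz' : G.OnLeft v u z') :
    h z - h z' = G.orientation u * (M.indicator 1 ⟨s(u, v), huv⟩ - ref ⟨s(u, v), huv⟩) := by
  by_cases hu : u ∈ G.white
  · rw [hh.2 u v huv hu hD z z' hz hz', ← indicator_one_apply, orientation, if_pos hu, one_mul]
  · have hv : v ∈ G.white := not_not.1 (mt (G.bipartite u v huv).2 hu)
    have hvu := hh.2 v u huv.symm hv hD.symm z' z hz' hz
    rw [show (⟨s(v, u), huv.symm⟩ : G.Edge) = ⟨s(u, v), huv⟩ from Subtype.ext Sym2.eq_swap,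
      ← indicator_one_apply] at hvu
    rw [orientation, if_neg hu]
    linarith

lemma IsHeight.sub_sub_sub_eq (hh : G.IsHeight ref D M h) (hh' : G.IsHeight ref D' M' h')
    (huv : G.graph.Adj u v) (hD : u ∈ D ∨ v ∈ D) (hD' : u ∈ D' ∨ v ∈ D')
    (hz : G.OnLeft u v z) (hz' : G.OnLeft v u z') :
    (h' z - h z) - (h' z' - h z') =
      G.orientation u * (M'.indicator 1 ⟨s(u, v), huv⟩ - M.indicator 1 ⟨s(u, v), huv⟩) := by
  linarith [hh.sub_eq huv hD hz hz', hh'.sub_eq huv hD' hz hz']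

lemma IsHeight.sameAcross_sub (hh : G.IsHeight ref D M h) (hh' : G.IsHeight ref D' M' h')
    (huv : G.graph.Adj u v) (hD : u ∈ D ∨ v ∈ D) (hD' : u ∈ D' ∨ v ∈ D')
    (hiff : ⟨s(u, v), huv⟩ ∈ M' ↔ ⟨s(u, v), huv⟩ ∈ M) :
    G.SameAcross (fun z => h' z - h z) u v := by
  intro z z' hz hz'
  have hsub := hh.sub_sub_sub_eq hh' huv hD hD' hz hz'
  rw [indicator_one_congr hiff, sub_self, mul_zero] at hsub
  exact sub_eq_zero.1 hsub

lemma IsHeight.exists_int_sub_sub_sub (hh : G.IsHeight ref D M h)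
    (hh' : G.IsHeight ref D' M' h') (hadj : G.AdjacentFaces (D ∩ D') z z') :
    ∃ k : ℤ, (h' z - h z) - (h' z' - h z') = k ∧ |(k : ℝ)| ≤ 1 := by
  obtain ⟨u, v, huv, hE, hz, hz'⟩ := hadj
  rw [hh.sub_sub_sub_eq hh' huv (hE.imp And.left And.left) (hE.imp And.right And.right) hz hz']
  obtain ⟨k, hk, hk1⟩ := exists_int_indicator_sub M M' ⟨s(u, v), huv⟩
  rw [hk]
  rcases orientation_eq_one_or (G := G) u with hu | hu <;> rw [hu]
  · exact ⟨k, one_mul _, hk1⟩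
  · exact ⟨-k, by simp, by simpa using hk1⟩

end IsHeight

/-! ### Faces of a domain -/

lemma FaceConst.of_imp {P : ℂ → Prop} (h : ∀ z, ∀ z' ∈ G.face z, P z → P z') : G.FaceConst P :=
  fun z z' hz => propext ⟨h z' z (mem_face_symm hz), h z z' hz⟩

lemma FaceConst.eq_of_onLeft {α : Type*} {f : ℂ → α} (hf : G.FaceConst f) {u v : V} {z y : ℂ}
    (hz : G.OnLeft u v z) (hy : G.OnLeft u v y) : f z = f y := by
  obtain ⟨t, ht, ht'⟩ := (hz.2.and hy.2).exists
  exact (hf z _ ht).symm.trans (hf y _ ht')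

lemma faceConst_isFaceOf (D : Set V) : G.FaceConst (G.IsFaceOf D) :=
  .of_imp fun z z' hz h => ⟨notMem_skeleton_of_mem_face hz, by rw [face_eq_of_mem hz]; exact h.2⟩

lemma faceConst_isBoundaryFace (D : Set V) : G.FaceConst (G.IsBoundaryFace D) :=
  .of_imp fun z z' hz h =>
    ⟨(faceConst_isFaceOf D z z' hz).mpr h.1, by rw [face_eq_of_mem hz]; exact h.2⟩

section AdjacentFaces

variable {D D' : Set V} {z z' : ℂ}

lemma IsFaceOf.mono (hD : D ⊆ D') (h : G.IsFaceOf D z) : G.IsFaceOf D' z :=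
  ⟨h.1, h.2.imp fun _ hv => ⟨hD hv.1, hv.2⟩⟩

lemma AdjacentFaces.symm (h : G.AdjacentFaces D z z') : G.AdjacentFaces D z' z := by
  obtain ⟨u, v, huv, hD, hz, hz'⟩ := h
  exact ⟨v, u, huv.symm, hD.symm, hz', hz⟩

lemma reflTransGen_adjacentFaces_symm (h : Relation.ReflTransGen (G.AdjacentFaces D) z z') :
    Relation.ReflTransGen (G.AdjacentFaces D) z' z :=
  have : Std.Symm (G.AdjacentFaces D) := ⟨fun _ _ => AdjacentFaces.symm⟩
  Std.Symm.symm _ _ h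

lemma AdjacentFaces.mono (hD : D ⊆ D') (h : G.AdjacentFaces D z z') : G.AdjacentFaces D' z z' := by
  obtain ⟨u, v, huv, huvD, hz, hz'⟩ := h
  exact ⟨u, v, huv, huvD.imp (@hD u) (@hD v), hz, hz'⟩

lemma AdjacentFaces.congr_right {y : ℂ} (h : G.AdjacentFaces D z z') (hy : y ∈ G.face z') :
    G.AdjacentFaces D z y := by
  obtain ⟨u, v, huv, hD, hz, hz'⟩ := h
  exact ⟨u, v, huv, hD, hz, hz'.congr hy⟩

lemma AdjacentFaces.isFaceOf_left (h : G.AdjacentFaces D z z') : G.IsFaceOf D z := by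
  obtain ⟨u, v, huv, hD | hD, hz, -⟩ := h
  · exact ⟨hz.1, u, hD, hz.pos_left_mem_closure huv⟩
  · exact ⟨hz.1, v, hD, hz.pos_right_mem_closure huv⟩

lemma AdjacentFaces.isFaceOf_right (h : G.AdjacentFaces D z z') : G.IsFaceOf D z' :=
  h.symm.isFaceOf_left

end AdjacentFaces

/-! ### Enclosed faces -/

/-- Exploration of the faces of `E` from its boundary: a face satisfying `Q` is explored as soon as
one of its neighbours is. -/
inductive Explored (G : PlaneBipartiteGraph V) (E : Set V) (Q : ℂ → Prop) : ℂ → Prop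
  | base {z : ℂ} : G.IsBoundaryFace E z → Explored G E Q z
  | step {z z' : ℂ} : Explored G E Q z → G.AdjacentFaces E z z' → Q z' → Explored G E Q z'

/-- The faces of `E` that the exploration from its boundary through `Q` does not reach. -/
def Enclosed (G : PlaneBipartiteGraph V) (E : Set V) (Q : ℂ → Prop) (z : ℂ) : Prop :=
  G.IsFaceOf E z ∧ ¬ G.Explored E Q z

/-- The edges with an enclosed face on both sides: on these the configurations are exchanged. -/
def enclosedEdges (G : PlaneBipartiteGraph V) (E : Set V) (Q : ℂ → Prop) : Set G.Edge :=
  {e | ∀ u v, e.1 = s(u, v) → ∀ z, G.OnLeft u v z → G.Enclosed E Q z}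

section Enclosed

variable {E : Set V} {Q : ℂ → Prop} {z z' : ℂ} {u v : V}

lemma Explored.isFaceOf (h : G.Explored E Q z) : G.IsFaceOf E z := by
  cases h with
  | base h => exact h.1
  | step _ hadj _ => exact hadj.isFaceOf_right

lemma explored_iff_of_adjacent {Q' : ℂ → Prop}
    (h : ∀ t z, G.Explored E Q t → G.AdjacentFaces E t z → (Q' z ↔ Q z)) :
    G.Explored E Q' z ↔ G.Explored E Q z := by
  constructor <;> intro hz
  · induction hz with
    | base hz => exact .base hz
    | step _ hadj hz ih => exact ih.step hadj ((h _ _ ih hadj).1 hz)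
  · induction hz with
    | base hz => exact .base hz
    | step hz' hadj hz ih => exact ih.step hadj ((h _ _ hz' hadj).2 hz)

lemma faceConst_explored (hQ : G.FaceConst Q) : G.FaceConst (G.Explored E Q) := by
  refine .of_imp fun z z' hz h => ?_
  cases h with
  | base h => exact .base ((faceConst_isBoundaryFace E z z' hz).mpr h)
  | step h hadj hq => exact .step h (hadj.congr_right hz) ((hQ _ _ hz).mpr hq)

lemma faceConst_enclosed (hQ : G.FaceConst Q) : G.FaceConst (G.Enclosed E Q) := fun z z' hz => by
  rw [Enclosed, Enclosed, faceConst_isFaceOf E z z' hz, faceConst_explored hQ z z' hz]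

lemma Enclosed.mem_of_mem_closure (h : G.Enclosed E Q z) (hv : G.pos v ∈ closure (G.face z)) :
    v ∈ E := by
  by_contra hvE
  exact h.2 (.base ⟨h.1, v, hvE, hv⟩)

lemma AdjacentFaces.inter_of_enclosed {D : Set V} (hadj : G.AdjacentFaces D z z')
    (h : G.Enclosed E Q z) : G.AdjacentFaces E z z' := by
  obtain ⟨u, v, huv, -, hz, hz'⟩ := hadj
  exact ⟨u, v, huv, Or.inl (h.mem_of_mem_closure (hz.pos_left_mem_closure huv)), hz, hz'⟩

lemma mk_mem_enclosedEdges_iff (hQ : G.FaceConst Q) (huv : G.graph.Adj u v)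
    (hz : G.OnLeft u v z) (hz' : G.OnLeft v u z') :
    (⟨s(u, v), huv⟩ : G.Edge) ∈ G.enclosedEdges E Q ↔ G.Enclosed E Q z ∧ G.Enclosed E Q z' := by
  constructor
  · exact fun h => ⟨h u v rfl z hz, h v u Sym2.eq_swap z' hz'⟩
  · rintro ⟨h, h'⟩ a b hab y hy
    rcases Sym2.eq_iff.1 hab with ⟨rfl, rfl⟩ | ⟨rfl, rfl⟩
    · exact ((faceConst_enclosed hQ).eq_of_onLeft hy hz).mpr h
    · exact ((faceConst_enclosed hQ).eq_of_onLeft hy hz').mpr h'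

lemma enclosedEdges_congr {Q' : ℂ → Prop} (h : ∀ z, G.Explored E Q' z ↔ G.Explored E Q z) :
    G.enclosedEdges E Q' = G.enclosedEdges E Q := by
  simp only [enclosedEdges, Enclosed, h]

lemma mem_of_mem_enclosedEdges {e : G.Edge} (he : e ∈ G.enclosedEdges E Q) (hv : v ∈ e.1) :
    v ∈ E := by
  obtain ⟨u, w, huw, rfl⟩ := exists_adj_eq_mk e
  obtain ⟨z, hz⟩ := exists_onLeft huw
  have henc : G.Enclosed E Q z := he u w rfl z hz
  rcases Sym2.mem_iff.1 hv with rfl | rfl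
  · exact henc.mem_of_mem_closure (hz.pos_left_mem_closure huw)
  · exact henc.mem_of_mem_closure (hz.pos_right_mem_closure huw)

lemma SameAcross.enclosed (h : G.SameAcross Q u v) (huv : G.graph.Adj u v) (hE : u ∈ E ∨ v ∈ E)
    (hexp : ∀ z, G.Explored E Q z → Q z) : G.SameAcross (G.Enclosed E Q) u v := by
  intro z z' hz hz'
  have hadj : G.AdjacentFaces E z z' := ⟨u, v, huv, hE, hz, hz'⟩
  have hQ : Q z = Q z' := h z z' hz hz'
  have hiff : G.Explored E Q z ↔ G.Explored E Q z' :=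
    ⟨fun hexpl => hexpl.step hadj (hQ.mp (hexp z hexpl)),
      fun hexpl => hexpl.step hadj.symm (hQ.mpr (hexp z' hexpl))⟩
  simp only [Enclosed, hadj.isFaceOf_left, hadj.isFaceOf_right, hiff]

lemma mem_enclosedEdges_of_rotate (hQ : G.FaceConst Q) (hexp : ∀ z, G.Explored E Q z → Q z)
    {x w w' : V} (hx : x ∈ E) (h : G.graph.Adj x w) (h' : G.graph.Adj x w')
    (hc : ∀ y, G.graph.Adj x y → y ≠ w → y ≠ w' → G.SameAcross Q x y)
    (hw : (⟨s(x, w), h⟩ : G.Edge) ∈ G.enclosedEdges E Q) :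
    (⟨s(x, w'), h'⟩ : G.Edge) ∈ G.enclosedEdges E Q := by
  rcases eq_or_ne w w' with rfl | hne
  · exact hw
  obtain ⟨l, hl⟩ := exists_onLeft h
  obtain ⟨r, hr⟩ := exists_onLeft h.symm
  obtain ⟨l', hl'⟩ := exists_onLeft h'
  obtain ⟨r', hr'⟩ := exists_onLeft h'.symm
  have henc := faceConst_enclosed (E := E) hQ
  have hcross (y : V) (hy : G.graph.Adj x y) (hyw : y ≠ w) (hyw' : y ≠ w') :
      G.SameAcross (G.Enclosed E Q) x y :=
    (hc y hy hyw hyw').enclosed hy (Or.inl hx) hexp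
  rw [mk_mem_enclosedEdges_iff hQ h hl hr] at hw
  rw [mk_mem_enclosedEdges_iff hQ h' hl' hr']
  exact ⟨(henc.eq_of_rotate h' h hne.symm (fun y hy hyw' hyw => hcross y hy hyw hyw')
    hl' hr).mpr hw.2, (henc.eq_of_rotate h h' hne hcross hl hr').mp hw.1⟩

end Enclosed

/-! ### Exchanging two configurations -/

section Ite

variable {A M N : G.Config} {e : G.Edge}

lemma mem_ite_of_mem (he : e ∈ A) : e ∈ A.ite M N ↔ e ∈ M := by
  simp [Set.ite, he]

lemma mem_ite_of_notMem (he : e ∉ A) : e ∈ A.ite M N ↔ e ∈ N := by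
  simp [Set.ite, he]

lemma ite_ite_ite (A M N : G.Config) : A.ite (A.ite M N) (A.ite N M) = M := by
  ext e
  by_cases he : e ∈ A
  · rw [mem_ite_of_mem he, mem_ite_of_mem he]
  · rw [mem_ite_of_notMem he, mem_ite_of_notMem he]

lemma exists_adj_eq_mk_of_mem {x : V} (hx : x ∈ e.1) :
    ∃ w, ∃ h : G.graph.Adj x w, e = ⟨s(x, w), h⟩ := by
  obtain ⟨u, v, h, rfl⟩ := exists_adj_eq_mk e
  rcases Sym2.mem_iff.1 hx with rfl | rfl
  · exact ⟨v, h, rfl⟩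
  · exact ⟨u, h.symm, Subtype.ext Sym2.eq_swap⟩

end Ite

section IsDimer

variable {D D' : Set V} {M M' : G.Config}

lemma IsDimer.ite (hM : G.IsDimer D M) (hM' : G.IsDimer D' M') {A : G.Config}
    (hA : ∀ e ∈ A, ∀ v ∈ e.1, v ∈ D ∩ D')
    (hAM : ∀ x, ∀ e ∈ M, ∀ e' ∈ M', x ∈ e.1 → x ∈ e'.1 → (e ∈ A ↔ e' ∈ A)) :
    G.IsDimer D (A.ite M' M) := by
  refine ⟨?_, fun x hx => ?_⟩
  · rintro e (⟨-, heA⟩ | ⟨he, -⟩) v hv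
    exacts [(hA e heA v hv).1, hM.1 e he v hv]
  obtain ⟨e, ⟨he, hxe⟩, he_unique⟩ := hM.2 x hx
  by_cases hfA : ∃ f ∈ A, x ∈ f.1
  · obtain ⟨f, hfA, hxf⟩ := hfA
    obtain ⟨e', ⟨he', hxe'⟩, he'_unique⟩ := hM'.2 x (hA f hfA x hxf).2
    have hee' : e ∈ A ↔ e' ∈ A := hAM x e he e' he' hxe hxe'
    by_cases heA : e ∈ A
    · refine ⟨e', ⟨Or.inl ⟨he', hee'.1 heA⟩, hxe'⟩, ?_⟩
      rintro c ⟨⟨hc, -⟩ | ⟨hc, hcA⟩, hxc⟩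
      · exact he'_unique c ⟨hc, hxc⟩
      · exact (hcA (he_unique c ⟨hc, hxc⟩ ▸ heA)).elim
    · refine ⟨e, ⟨Or.inr ⟨he, heA⟩, hxe⟩, ?_⟩
      rintro c ⟨⟨hc, hcA⟩ | ⟨hc, -⟩, hxc⟩
      · exact (heA (hee'.2 (he'_unique c ⟨hc, hxc⟩ ▸ hcA))).elim
      · exact he_unique c ⟨hc, hxc⟩
  · refine ⟨e, ⟨Or.inr ⟨he, fun heA => hfA ⟨e, heA, hxe⟩⟩, hxe⟩, ?_⟩
    rintro c ⟨⟨-, hcA⟩ | ⟨hc, -⟩, hxc⟩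
    · exact (hfA ⟨c, hcA, hxc⟩).elim
    · exact he_unique c ⟨hc, hxc⟩

lemma IsDimer.eq_of_mem (hM : G.IsDimer D M) {x : V} (hx : x ∈ D) {e e' : G.Edge} (he : e ∈ M)
    (he' : e' ∈ M) (hxe : x ∈ e.1) (hxe' : x ∈ e'.1) : e = e' :=
  (hM.2 x hx).unique ⟨he, hxe⟩ ⟨he', hxe'⟩

lemma IsDimer.ite_enclosedEdges (hM : G.IsDimer D M) (hM' : G.IsDimer D' M') {Q : ℂ → Prop}
    (hQ : G.FaceConst Q) (hexp : ∀ z, G.Explored (D ∩ D') Q z → Q z)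
    (hc : ∀ u v, ∀ h : G.graph.Adj u v, u ∈ D ∩ D' → ⟨s(u, v), h⟩ ∉ M → ⟨s(u, v), h⟩ ∉ M' →
      G.SameAcross Q u v) :
    G.IsDimer D ((G.enclosedEdges (D ∩ D') Q).ite M' M) := by
  refine hM.ite hM' (fun e he v hv => mem_of_mem_enclosedEdges he hv)
    fun x e he e' he' hxe hxe' => ?_
  have hx : x ∈ D ∩ D' := ⟨hM.1 e he x hxe, hM'.1 e' he' x hxe'⟩
  obtain ⟨w, h, rfl⟩ := exists_adj_eq_mk_of_mem hxe
  obtain ⟨w', h', rfl⟩ := exists_adj_eq_mk_of_mem hxe'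
  have hcross (y : V) (hy : G.graph.Adj x y) (hyw : y ≠ w) (hyw' : y ≠ w') :
      G.SameAcross Q x y := by
    refine hc x y hy hx (fun hmem => hyw ?_) fun hmem => hyw' ?_
    · exact Sym2.congr_right.1 (congrArg Subtype.val
        (hM.eq_of_mem hx.1 hmem he (Sym2.mem_mk_left x y) hxe))
    · exact Sym2.congr_right.1 (congrArg Subtype.val
        (hM'.eq_of_mem hx.2 hmem he' (Sym2.mem_mk_left x y) hxe'))
  exact ⟨mem_enclosedEdges_of_rotate hQ hexp hx h h' hcross,
    mem_enclosedEdges_of_rotate hQ hexp hx h' h fun y hy hyw' hyw => hcross y hy hyw hyw'⟩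

end IsDimer

/-- Normalized heights for all configurations on `D` and on `D'`, which stay within `K` of each
other on the boundary of `D ∩ D'`. -/
structure HeightPair (G : PlaneBipartiteGraph V) (ref : G.Edge → ℝ) (D D' : Set V) (K : ℝ) where
  fst : G.Config → ℂ → ℝ
  snd : G.Config → ℂ → ℝ
  isNormalizedHeight_fst : G.IsNormalizedHeight ref D fst
  isNormalizedHeight_snd : G.IsNormalizedHeight ref D' snd
  bound : ∀ M M', G.IsDimer D M → G.IsDimer D' M' →
    ∀ z, G.IsBoundaryFace (D ∩ D') z → |snd M' z - fst M z| ≤ K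

/-- The two values of the gap lie in `±(K, K + 1]`. Equal signs leave no room for a nonzero integer
between them, and opposite signs would make their difference exceed `2 * K`. -/
lemma eq_of_reflection {K a b x y : ℝ} (ha : |a| ≤ 2 * K) (hb : |b| ≤ 2 * K)
    (hx : |x| ∈ Set.Ioc K (K + 1)) (hy : |y| ∈ Set.Ioc K (K + 1)) (h : a + 2 * x = b + 2 * y)
    (hint : ∃ k : ℤ, x - y = k) : x = y := by
  obtain ⟨k, hk⟩ := hint
  have hlt : |x - y| < 1 := by
    obtain ⟨⟨hx₁, hx₂⟩, hy₁, hy₂⟩ := And.intro hx hy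
    rw [abs_le] at ha hb
    rw [abs_lt]
    rcases abs_cases x with ⟨hxe, -⟩ | ⟨hxe, -⟩ <;> rcases abs_cases y with ⟨hye, -⟩ | ⟨hye, -⟩ <;>
      rw [hxe] at hx₁ hx₂ <;> rw [hye] at hy₁ hy₂ <;> constructor <;> linarith
  rw [hk] at hlt
  have hk0 : k = 0 := Int.abs_lt_one_iff.1 (by exact_mod_cast hlt)
  rw [hk0, Int.cast_zero] at hk
  exact sub_eq_zero.1 hk

namespace HeightPair

variable {ref : G.Edge → ℝ} {D D' : Set V} {K : ℝ} (p : G.HeightPair ref D D' K)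

/-- The same heights, with the roles of the two domains exchanged. -/
def symm : G.HeightPair ref D' D K where
  fst := p.snd
  snd := p.fst
  isNormalizedHeight_fst := p.isNormalizedHeight_snd
  isNormalizedHeight_snd := p.isNormalizedHeight_fst
  bound M M' hM hM' z hz := by
    rw [abs_sub_comm]
    exact p.bound M' M hM' hM z (by rwa [Set.inter_comm])

variable (M M' : G.Config) (z : ℂ)

/-- The gap between the heights of two configurations. -/
def gap : ℝ := p.snd M' z - p.fst M z

/-- The heights of the two configurations are within `K` of each other. -/
def Near : Prop := |p.gap M M' z| ≤ K

/-- The exploration from the boundary of `D ∩ D'` through the faces with nearby heights. -/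
abbrev IsExplored : Prop := G.Explored (D ∩ D') (p.Near M M') z

/-- The faces that the exploration does not reach. -/
abbrev IsEnclosed : Prop := G.Enclosed (D ∩ D') (p.Near M M') z

/-- The edges on which the configurations are exchanged. -/
def gapEdges : Set G.Edge := G.enclosedEdges (D ∩ D') (p.Near M M')

/-- The configuration on `D` obtained by exchanging `M` and `M'` on the enclosed edges. Its
counterpart on `D'` is `p.symm.exchange M' M`. -/
def exchange : G.Config := (p.gapEdges M M').ite M' M

/-- The effect of the exchange on the height on `D`. -/
def heightChange : ℝ := p.fst (p.exchange M M') z - p.fst M z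

/-- The enclosed faces next to an explored face. -/
def IsRim : Prop :=
  p.IsEnclosed M M' z ∧ ∃ t, p.IsExplored M M' t ∧ G.AdjacentFaces (D ∩ D') t z

/-- Adjacency between enclosed faces. -/
def EnclosedLink (z z' : ℂ) : Prop :=
  p.IsEnclosed M M' z ∧ p.IsEnclosed M M' z' ∧ G.AdjacentFaces (D ∩ D') z z'

lemma symm_gap : p.symm.gap M' M z = -p.gap M M' z :=
  (neg_sub _ _).symm

lemma symm_near : p.symm.Near M' M = p.Near M M' := by
  funext z
  rw [Near, symm_gap, abs_neg, Near]

lemma symm_gapEdges : p.symm.gapEdges M' M = p.gapEdges M M' := by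
  rw [gapEdges, symm_near, Set.inter_comm, gapEdges]

lemma symm_exchange : p.symm.exchange M' M = (p.gapEdges M M').ite M M' := by
  rw [exchange, symm_gapEdges]

variable {M M' z} {z' : ℂ}

lemma symm_isExplored : p.symm.IsExplored M' M z ↔ p.IsExplored M M' z := by
  rw [IsExplored, symm_near, Set.inter_comm]

lemma symm_isEnclosed : p.symm.IsEnclosed M' M z ↔ p.IsEnclosed M M' z := by
  rw [IsEnclosed, symm_near, Set.inter_comm]

lemma symm_isRim : p.symm.IsRim M' M z ↔ p.IsRim M M' z := by
  simp only [IsRim, symm_isEnclosed, symm_isExplored, Set.inter_comm D' D]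

lemma symm_reflTransGen_enclosedLink {c w : ℂ}
    (h : Relation.ReflTransGen (p.EnclosedLink M M') c w) :
    Relation.ReflTransGen (p.symm.EnclosedLink M' M) c w :=
  Relation.ReflTransGen.mono (fun _ _ hlink => ⟨p.symm_isEnclosed.2 hlink.1,
    p.symm_isEnclosed.2 hlink.2.1, Set.inter_comm D D' ▸ hlink.2.2⟩) _ _ h

lemma isExplored_of_not_isEnclosed (hz : G.IsFaceOf (D ∩ D') z) (h : ¬ p.IsEnclosed M M' z) :
    p.IsExplored M M' z :=
  not_not.1 fun hexp => h ⟨hz, hexp⟩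

lemma isRim_of_adjacent (hadj : G.AdjacentFaces D z z') (hz : p.IsEnclosed M M' z)
    (hz' : ¬ p.IsEnclosed M M' z') : p.IsRim M M' z :=
  have hadjE := hadj.inter_of_enclosed hz
  ⟨hz, z', p.isExplored_of_not_isEnclosed hadjE.isFaceOf_right hz', hadjE.symm⟩

section IsDimer

variable (hM : G.IsDimer D M) (hM' : G.IsDimer D' M')
include hM hM'

lemma faceConst_gap : G.FaceConst (p.gap M M') := fun z z' hz => by
  rw [gap, gap, (p.isNormalizedHeight_fst.1 M hM).faceConst z z' hz,
    (p.isNormalizedHeight_snd.1 M' hM').faceConst z z' hz]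

lemma faceConst_near : G.FaceConst (p.Near M M') := fun z z' hz => by
  rw [Near, p.faceConst_gap hM hM' z z' hz, Near]

lemma near_of_isExplored (hz : p.IsExplored M M' z) : p.Near M M' z := by
  cases hz with
  | base hz => exact p.bound M M' hM hM' z hz
  | step _ _ hz => exact hz

lemma exists_int_gap_sub (hadj : G.AdjacentFaces (D ∩ D') z z') :
    ∃ k : ℤ, p.gap M M' z - p.gap M M' z' = k ∧ |(k : ℝ)| ≤ 1 :=
  (p.isNormalizedHeight_fst.1 M hM).exists_int_sub_sub_sub (p.isNormalizedHeight_snd.1 M' hM') hadj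

lemma isDimer_exchange : G.IsDimer D (p.exchange M M') := by
  refine hM.ite_enclosedEdges hM' (p.faceConst_near hM hM')
    (fun z => p.near_of_isExplored hM hM') fun u v huv hu hnM hnM' z z' hz hz' => ?_
  have hgap : p.gap M M' z = p.gap M M' z' :=
    (p.isNormalizedHeight_fst.1 M hM).sameAcross_sub (p.isNormalizedHeight_snd.1 M' hM') huv
      (Or.inl hu.1) (Or.inl hu.2) (iff_of_false hnM' hnM) z z' hz hz'
  rw [Near, hgap, Near]

lemma heightChange_eq_of_adjacent (hadj : G.AdjacentFaces D z z')
    (h : ¬ (p.IsEnclosed M M' z ∧ p.IsEnclosed M M' z')) :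
    p.heightChange M M' z = p.heightChange M M' z' := by
  obtain ⟨u, v, huv, hD, hz, hz'⟩ := hadj
  refine (p.isNormalizedHeight_fst.1 M hM).sameAcross_sub
    (p.isNormalizedHeight_fst.1 _ (p.isDimer_exchange hM hM')) huv hD hD
    (mem_ite_of_notMem fun hmem => h ?_) z z' hz hz'
  exact (mk_mem_enclosedEdges_iff (p.faceConst_near hM hM') huv hz hz').1 hmem

lemma heightChange_sub_eq_gap_sub (h : p.EnclosedLink M M' z z') :
    p.heightChange M M' z - p.heightChange M M' z' = p.gap M M' z - p.gap M M' z' := by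
  obtain ⟨henc, henc', u, v, huv, hE, hz, hz'⟩ := h
  have hmem : (⟨s(u, v), huv⟩ : G.Edge) ∈ p.gapEdges M M' :=
    (mk_mem_enclosedEdges_iff (p.faceConst_near hM hM') huv hz hz').2 ⟨henc, henc'⟩
  have hD := hE.imp And.left And.left
  have hh := p.isNormalizedHeight_fst.1 M hM
  have hh₁ := p.isNormalizedHeight_fst.1 _ (p.isDimer_exchange hM hM')
  have hchange := hh.sub_sub_sub_eq hh₁ huv hD hD hz hz'
  rw [exchange, indicator_one_congr (mem_ite_of_mem hmem)] at hchange
  exact hchange.trans (hh.sub_sub_sub_eq (p.isNormalizedHeight_snd.1 M' hM') huv hD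
    (hE.imp And.right And.right) hz hz').symm

/-- Here `p.symm.heightChange M' M z - p.heightChange M M' z` is the change of the gap. -/
lemma abs_heightChange_sub_le (hz : p.IsExplored M M' z) :
    |p.symm.heightChange M' M z - p.heightChange M M' z| ≤ 2 * K := by
  induction hz with
  | base hz =>
    have h := abs_le.1 (p.bound M M' hM hM' _ hz)
    have h₁ := abs_le.1 (p.bound _ _ (p.isDimer_exchange hM hM')
      (p.symm.isDimer_exchange hM' hM) _ hz)
    rw [abs_le, heightChange, heightChange]
    change _ ≤ p.snd _ _ - p.snd _ _ - _ ∧ p.snd _ _ - p.snd _ _ - _ ≤ _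
    constructor <;> linarith
  | step hz hadj _ ih =>
    rwa [← p.heightChange_eq_of_adjacent hM hM' (hadj.mono Set.inter_subset_left)
        fun henc => henc.1.2 hz,
      ← p.symm.heightChange_eq_of_adjacent hM' hM (hadj.mono Set.inter_subset_right)
        fun henc => (p.symm_isEnclosed.1 henc.1).2 hz]

lemma IsRim.abs_heightChange_sub_le (hz : p.IsRim M M' z) :
    |p.symm.heightChange M' M z - p.heightChange M M' z| ≤ 2 * K := by
  obtain ⟨-, t, ht, hadj⟩ := hz
  rw [← p.heightChange_eq_of_adjacent hM hM' (hadj.mono Set.inter_subset_left)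
      fun henc => henc.1.2 ht,
    ← p.symm.heightChange_eq_of_adjacent hM' hM (hadj.mono Set.inter_subset_right)
      fun henc => (p.symm_isEnclosed.1 henc.1).2 ht]
  exact p.abs_heightChange_sub_le hM hM' ht

lemma IsRim.abs_gap_mem_Ioc (hz : p.IsRim M M' z) : |p.gap M M' z| ∈ Set.Ioc K (K + 1) := by
  obtain ⟨henc, t, ht, hadj⟩ := hz
  refine ⟨not_le.1 fun hle => henc.2 (ht.step hadj hle), ?_⟩
  obtain ⟨k, hk, hk1⟩ := p.exists_int_gap_sub hM hM' hadj
  have ht_near : |p.gap M M' t| ≤ K := p.near_of_isExplored hM hM' ht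
  rw [show p.gap M M' z = p.gap M M' t - k by linarith]
  linarith [abs_sub (p.gap M M' t) k]

lemma heightChange_sub_gap_eq {c w : ℂ}
    (h : Relation.ReflTransGen (p.EnclosedLink M M') c w) :
    p.heightChange M M' c - p.gap M M' c = p.heightChange M M' w - p.gap M M' w := by
  induction h with
  | refl => rfl
  | tail _ hlink ih => linarith [p.heightChange_sub_eq_gap_sub hM hM' hlink]

lemma exists_int_gap_sub_of_reflTransGen {c w : ℂ}
    (h : Relation.ReflTransGen (p.EnclosedLink M M') c w) :
    ∃ k : ℤ, p.gap M M' c - p.gap M M' w = k := by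
  induction h with
  | refl => exact ⟨0, by simp⟩
  | tail _ hlink ih =>
    obtain ⟨k, hk⟩ := ih
    obtain ⟨j, hj, -⟩ := p.exists_int_gap_sub hM hM' hlink.2.2
    exact ⟨k + j, by push_cast; linarith⟩

lemma IsRim.gap_eq {c c' : ℂ} (hc : p.IsRim M M' c) (hc' : p.IsRim M M' c')
    (h : Relation.ReflTransGen (p.EnclosedLink M M') c c') :
    p.gap M M' c = p.gap M M' c' := by
  have hfst := p.heightChange_sub_gap_eq hM hM' h
  have hsnd := p.symm.heightChange_sub_gap_eq hM' hM (p.symm_reflTransGen_enclosedLink h)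
  rw [symm_gap, symm_gap] at hsnd
  exact eq_of_reflection (hc.abs_heightChange_sub_le p hM hM')
    (hc'.abs_heightChange_sub_le p hM hM') (hc.abs_gap_mem_Ioc p hM hM')
    (hc'.abs_gap_mem_Ioc p hM hM') (by linarith) (p.exists_int_gap_sub_of_reflTransGen hM hM' h)

lemma heightChange_eq_zero_of_reflTransGen {b w : ℂ} (hb : G.IsBoundaryFace D b)
    (hfix : ∀ M₁ M₂, G.IsDimer D M₁ → G.IsDimer D M₂ → p.fst M₁ b = p.fst M₂ b)
    (h : Relation.ReflTransGen (G.AdjacentFaces D) b w) :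
    (¬ p.IsEnclosed M M' w → p.heightChange M M' w = 0) ∧
      (p.IsEnclosed M M' w → ∃ c, p.IsRim M M' c ∧ p.heightChange M M' c = 0 ∧
        Relation.ReflTransGen (p.EnclosedLink M M') c w) := by
  induction h with
  | refl =>
    obtain ⟨v, hv, hvb⟩ := hb.2
    exact ⟨fun _ => sub_eq_zero.2 (hfix _ _ (p.isDimer_exchange hM hM') hM),
      fun henc => (hv (henc.mem_of_mem_closure hvb).1).elim⟩
  | @tail w w' _ hadj ih =>
    refine ⟨fun hw' => ?_, fun hw' => ?_⟩
    · rw [← p.heightChange_eq_of_adjacent hM hM' hadj fun henc => hw' henc.2]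
      by_cases hw : p.IsEnclosed M M' w
      · obtain ⟨c, hc, hc0, hcw⟩ := ih.2 hw
        have hgap := hc.gap_eq p hM hM' (p.isRim_of_adjacent hadj hw hw') hcw
        linarith [p.heightChange_sub_gap_eq hM hM' hcw]
      · exact ih.1 hw
    · by_cases hw : p.IsEnclosed M M' w
      · obtain ⟨c, hc, hc0, hcw⟩ := ih.2 hw
        exact ⟨c, hc, hc0, hcw.tail ⟨hw, hw', hadj.inter_of_enclosed hw⟩⟩
      · refine ⟨w', p.isRim_of_adjacent hadj.symm hw' hw, ?_, .refl⟩
        rw [← p.heightChange_eq_of_adjacent hM hM' hadj fun henc => hw henc.1]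
        exact ih.1 hw

lemma heightChange_eq_zero (hz : p.IsExplored M M' z ∨ p.IsRim M M' z) :
    p.heightChange M M' z = 0 := by
  have hface : G.IsFaceOf D z :=
    (hz.elim Explored.isFaceOf fun h => h.1.1).mono Set.inter_subset_left
  obtain ⟨b, hb, hpath, hfix⟩ := p.isNormalizedHeight_fst.2 z hface
  obtain ⟨hout, hin⟩ := p.heightChange_eq_zero_of_reflTransGen hM hM' hb hfix
    (reflTransGen_adjacentFaces_symm hpath)
  rcases hz with hz | hz
  · exact hout fun henc => henc.2 hz
  · obtain ⟨c, hc, hc0, hcz⟩ := hin hz.1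
    linarith [p.heightChange_sub_gap_eq hM hM' hcz, hc.gap_eq p hM hM' hz hcz]

lemma gap_exchange (hz : p.IsExplored M M' z ∨ p.IsRim M M' z) :
    p.gap (p.exchange M M') (p.symm.exchange M' M) z = p.gap M M' z := by
  have hfst := sub_eq_zero.1 (p.heightChange_eq_zero hM hM' hz)
  have hsnd := sub_eq_zero.1 (p.symm.heightChange_eq_zero hM' hM
    (hz.imp p.symm_isExplored.2 p.symm_isRim.2))
  exact congrArg₂ (· - ·) hsnd hfst

lemma gapEdges_exchange :
    p.gapEdges (p.exchange M M') (p.symm.exchange M' M) = p.gapEdges M M' := by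
  refine enclosedEdges_congr fun z => explored_iff_of_adjacent fun t z ht hadj => ?_
  rw [Near, p.gap_exchange hM hM', Near]
  by_cases henc : p.IsEnclosed M M' z
  · exact Or.inr ⟨henc, t, ht, hadj⟩
  · exact Or.inl (p.isExplored_of_not_isEnclosed hadj.isFaceOf_right henc)

lemma exchange_exchange :
    p.exchange (p.exchange M M') (p.symm.exchange M' M) = M := by
  rw [exchange, p.gapEdges_exchange hM hM', symm_exchange, exchange, ite_ite_ite]

end IsDimer

end HeightPair

/-! ### Large gaps enclose finite sets of edges -/

/-- A gap at `o` of more than `K + t` forces `z` to be enclosed, with a gap at `z` which is smaller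
by at most `t`, whatever the domains, the configurations and their heights. -/
def GapForces (G : PlaneBipartiteGraph V) (ref : G.Edge → ℝ) (o z : ℂ) (t : ℝ) : Prop :=
  ∀ ⦃D D' : Set V⦄ ⦃K : ℝ⦄ (p : G.HeightPair ref D D' K) ⦃M M' : G.Config⦄,
    G.IsDimer D M → G.IsDimer D' M' → G.IsFaceOf (D ∩ D') o → K + t < |p.gap M M' o| →
      p.IsEnclosed M M' z ∧ |p.gap M M' o| - t ≤ |p.gap M M' z|

section GapForces

variable {ref : G.Edge → ℝ} {o z z' : ℂ} {t : ℝ}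

lemma gapForces_self : G.GapForces ref o o 0 := fun D D' K p M M' hM hM' ho hgap =>
  ⟨⟨ho, fun hexp => (p.near_of_isExplored hM hM' hexp).not_gt (by linarith)⟩, by linarith⟩

lemma GapForces.of_mem_face (h : G.GapForces ref o z t) (hz : z' ∈ G.face z) :
    G.GapForces ref o z' t := fun D D' K p M M' hM hM' ho hgap => by
  obtain ⟨henc, hle⟩ := h p hM hM' ho hgap
  exact ⟨(faceConst_enclosed (p.faceConst_near hM hM') z z' hz).mpr henc,
    by rwa [p.faceConst_gap hM hM' z z' hz]⟩

lemma GapForces.cross (h : G.GapForces ref o z t) {u v : V} (huv : G.graph.Adj u v)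
    (hz : G.OnLeft u v z) (hz' : G.OnLeft v u z') : G.GapForces ref o z' (t + 1) :=
  fun D D' K p M M' hM hM' ho hgap => by
  obtain ⟨henc, hle⟩ := h p hM hM' ho (by linarith)
  have hadj : G.AdjacentFaces (D ∩ D') z z' :=
    ⟨u, v, huv, Or.inl (henc.mem_of_mem_closure (hz.pos_left_mem_closure huv)), hz, hz'⟩
  obtain ⟨k, hk, hk1⟩ := p.exists_int_gap_sub hM hM' hadj
  have hstep : |p.gap M M' z| ≤ |p.gap M M' z'| + 1 := by
    linarith [abs_sub_abs_le_abs_sub (p.gap M M' z) (p.gap M M' z'), hk ▸ hk1]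
  refine ⟨⟨hadj.isFaceOf_right, fun hexp => ?_⟩, by linarith⟩
  have hnear : |p.gap M M' z'| ≤ K := p.near_of_isExplored hM hM' hexp
  linarith

lemma exists_gapForces (ho : o ∉ G.skeleton) (hz : z ∉ G.skeleton) :
    ∃ t, G.GapForces ref o z t := by
  have hface : G.FaceConst fun z => ∃ t, G.GapForces ref o z t :=
    .of_imp fun z z' hz h => h.imp fun t ht => ht.of_mem_face hz
  refine (hface.eq_of_isOpen isPreconnected_univ isOpen_univ (fun u v huv _ y y' hy hy' => ?_)
    (Set.mem_univ o) (Set.mem_univ z) ho hz).mp ⟨0, gapForces_self⟩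
  exact propext ⟨fun ⟨t, ht⟩ => ⟨t + 1, ht.cross huv hy hy'⟩,
    fun ⟨t, ht⟩ => ⟨t + 1, ht.cross huv.symm hy' hy⟩⟩

lemma eventually_subset_gapEdges (ref : G.Edge → ℝ) (ho : o ∉ G.skeleton) {W : Set G.Edge}
    (hW : W.Finite) :
    ∀ᶠ t : ℝ in atTop, ∀ ⦃D D' : Set V⦄ ⦃K : ℝ⦄ (p : G.HeightPair ref D D' K)
      ⦃M M' : G.Config⦄, G.IsDimer D M → G.IsDimer D' M' → G.IsFaceOf (D ∩ D') o →
        K + t < |p.gap M M' o| → W ⊆ p.gapEdges M M' := by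
  suffices h : ∀ e ∈ W, ∀ᶠ t : ℝ in atTop, ∀ ⦃D D' : Set V⦄ ⦃K : ℝ⦄
      (p : G.HeightPair ref D D' K) ⦃M M' : G.Config⦄, G.IsDimer D M → G.IsDimer D' M' →
        G.IsFaceOf (D ∩ D') o → K + t < |p.gap M M' o| → e ∈ p.gapEdges M M' by
    filter_upwards [(Filter.eventually_all_finite hW).2 h] with t ht D D' K p M M' hM hM' hf hgap
    exact fun e he => ht e he p hM hM' hf hgap
  rintro e -
  obtain ⟨u, v, huv, rfl⟩ := exists_adj_eq_mk e
  obtain ⟨z, hz⟩ := exists_onLeft huv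
  obtain ⟨z', hz'⟩ := exists_onLeft huv.symm
  obtain ⟨a, ha⟩ := exists_gapForces (ref := ref) ho hz.1
  obtain ⟨b, hb⟩ := exists_gapForces (ref := ref) ho hz'.1
  filter_upwards [eventually_ge_atTop a, eventually_ge_atTop b]
    with t hat hbt D D' K p M M' hM hM' hf hgap
  exact (mk_mem_enclosedEdges_iff (p.faceConst_near hM hM') huv hz hz').2
    ⟨(ha p hM hM' hf (by linarith)).1, (hb p hM hM' hf (by linarith)).1⟩

end GapForces

/-! ### Heights of configurations which agree outside a disc -/

/-- `D` contains the vertices in the disc of radius `R + 1` and the endpoints of the edges which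
meet it, so that heights on `D` are defined all around the disc of radius `R`. -/
structure CoversDisc (G : PlaneBipartiteGraph V) (D : Set V) (R : ℝ) : Prop where
  vertex : ∀ v, ‖G.pos v‖ ≤ R + 1 → v ∈ D
  edge : ∀ e ∈ G.edgesMeeting (R + 1), ∀ v ∈ e.1, v ∈ D

lemma exists_mem_face_annulus {w p q : ℂ} {R : ℝ} (hp : p ∈ G.face w) (hpR : ‖p‖ < R + 1)
    (hq : q ∈ G.face w) (hqR : R < ‖q‖) : ∃ y ∈ G.face w, ‖y‖ ∈ Set.Ioo R (R + 1) := by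
  by_cases hpR' : R < ‖p‖
  · exact ⟨p, hp, hpR', hpR⟩
  obtain ⟨c, hRc, hc⟩ : ∃ c, R < c ∧ c < min ‖q‖ (R + 1) :=
    exists_between (lt_min hqR (by linarith))
  obtain ⟨hcq, hcR⟩ := lt_min_iff.1 hc
  obtain ⟨y, hy, rfl⟩ := isPreconnected_connectedComponentIn.intermediate_value hp hq
    continuous_norm.continuousOn ⟨(not_lt.1 hpR').trans hRc.le, hcq.le⟩
  exact ⟨y, hy, hRc, hcR⟩

lemma exists_mem_face_lt_norm {w p : ℂ} {R : ℝ} (hp : p ∈ closure (G.face w)) (hR : R < ‖p‖) :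
    ∃ y ∈ G.face w, R < ‖y‖ :=
  let ⟨y, hyR, hy⟩ := mem_closure_iff.1 hp _ (isOpen_lt continuous_const continuous_norm) hR
  ⟨y, hy, hyR⟩

lemma exists_mem_face_norm_lt {w p : ℂ} {R : ℝ} (hp : p ∈ closure (G.face w)) (hR : ‖p‖ < R) :
    ∃ y ∈ G.face w, ‖y‖ < R :=
  let ⟨y, hyR, hy⟩ := mem_closure_iff.1 hp _ (isOpen_lt continuous_norm continuous_const) hR
  ⟨y, hy, hyR⟩

section IsHeight

variable {ref : G.Edge → ℝ} {D D' : Set V} {R : ℝ} {M N : G.Config} {f g : ℂ → ℝ}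

lemma IsHeight.sub_eq_sub_of_isOpen (hf : G.IsHeight ref D M f) (hg : G.IsHeight ref D' N g)
    {U : Set ℂ} (hU : IsPreconnected U) (hUo : IsOpen U)
    (hMN : ∀ e : G.Edge, (G.edgeSegment e ∩ U).Nonempty →
      (∀ v ∈ e.1, v ∈ D ∩ D') ∧ (e ∈ N ↔ e ∈ M))
    {z z' : ℂ} (hz : z ∈ U) (hz' : z' ∈ U) (hzs : z ∉ G.skeleton) (hzs' : z' ∉ G.skeleton) :
    g z - f z = g z' - f z' := by
  have hface : G.FaceConst fun z => g z - f z := fun z z' hz => by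
    simp only [hf.faceConst z z' hz, hg.faceConst z z' hz]
  refine hface.eq_of_isOpen hU hUo (fun u v huv hmeet => ?_) hz hz' hzs hzs'
  obtain ⟨hmem, hiff⟩ := hMN ⟨s(u, v), huv⟩ (by rwa [edgeSegment_mk])
  have hu := hmem u (Sym2.mem_mk_left u v)
  exact hf.sameAcross_sub hg huv (Or.inl hu.1) (Or.inl hu.2) hiff

lemma IsHeight.sub_eq_sub_annulus (hf : G.IsHeight ref D M f) (hg : G.IsHeight ref D N g)
    (hD : G.CoversDisc D R) (hR : 0 ≤ R) (hMN : ∀ e, e ∉ G.edgesInside R → (e ∈ N ↔ e ∈ M))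
    {y y' : ℂ} (hy : ‖y‖ ∈ Set.Ioo R (R + 1)) (hy' : ‖y'‖ ∈ Set.Ioo R (R + 1))
    (hys : y ∉ G.skeleton) (hys' : y' ∉ G.skeleton) : g y - f y = g y' - f y' := by
  have hannulus := isPreconnected_setOf_norm_sub_mem (by simp [Complex.rank_real_complex]) (0 : ℂ)
    (isPreconnected_Ioo (a := R) (b := R + 1)) fun r hr => hR.trans_lt hr.1
  simp only [sub_zero] at hannulus
  refine hf.sub_eq_sub_of_isOpen hg hannulus (isOpen_Ioo.preimage continuous_norm) ?_ hy hy' hys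
    hys'
  rintro e ⟨p, hp, hpR, hpR'⟩
  have hmeet : e ∈ G.edgesMeeting (R + 1) := ⟨p, hp, mem_closedBall_zero_iff.2 hpR'.le⟩
  exact ⟨fun v hv => ⟨hD.edge e hmeet v hv, hD.edge e hmeet v hv⟩,
    hMN e fun hin => hpR.not_ge (mem_closedBall_zero_iff.1 (hin hp))⟩

lemma IsHeight.exists_eq_annulus (hf : G.IsHeight ref D M f) (hg : G.IsHeight ref D' N g)
    {w p q : ℂ} (hfg : g w = f w) (hp : p ∈ closure (G.face w)) (hpR : ‖p‖ < R + 1)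
    (hq : q ∈ G.face w) (hqR : R < ‖q‖) :
    ∃ y, ‖y‖ ∈ Set.Ioo R (R + 1) ∧ y ∉ G.skeleton ∧ g y = f y := by
  obtain ⟨p', hp', hpR'⟩ := exists_mem_face_norm_lt hp hpR
  obtain ⟨y, hy, hyR⟩ := exists_mem_face_annulus hp' hpR' hq hqR
  exact ⟨y, hyR, notMem_skeleton_of_mem_face hy,
    by rw [hf.faceConst w y hy, hg.faceConst w y hy, hfg]⟩

/-- As long as a path from the boundary of `D` crosses no edge inside the disc, the heights agree
along it; before it does, it visits a face meeting the annulus. -/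
lemma IsHeight.eq_or_exists_eq_annulus (hf : G.IsHeight ref D M f) (hg : G.IsHeight ref D N g)
    (hD : G.CoversDisc D R) (hMN : ∀ e, e ∉ G.edgesInside R → (e ∈ N ↔ e ∈ M))
    {b w : ℂ} (hb : G.IsBoundaryFace D b) (hfg : g b = f b)
    (hpath : Relation.ReflTransGen (G.AdjacentFaces D) b w) :
    (g w = f w ∧ ∃ q ∈ G.face w, R < ‖q‖) ∨
      ∃ y, ‖y‖ ∈ Set.Ioo R (R + 1) ∧ y ∉ G.skeleton ∧ g y = f y := by
  induction hpath with
  | refl =>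
    obtain ⟨v, hv, hvb⟩ := hb.2
    have hvR : R < ‖G.pos v‖ := not_le.1 fun hle => hv (hD.vertex v (by linarith))
    exact Or.inl ⟨hfg, exists_mem_face_lt_norm hvb hvR⟩
  | tail _ hadj ih =>
    refine ih.elim (fun ⟨hw, q, hq, hqR⟩ => ?_) Or.inr
    obtain ⟨u, v, huv, huD, hz, hz'⟩ := hadj
    by_cases hin : (⟨s(u, v), huv⟩ : G.Edge) ∈ G.edgesInside R
    · have huR := mem_closedBall_zero_iff.1
        (hin (pos_mem_edgeSegment (e := ⟨s(u, v), huv⟩) (Sym2.mem_mk_left u v)))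
      exact Or.inr (hf.exists_eq_annulus hg hw (hz.pos_left_mem_closure huv) (by linarith) hq hqR)
    · obtain ⟨p, hp, hpR⟩ := Set.not_subset.1 hin
      rw [edgeSegment_mk, segment_symm] at hp
      rw [mem_closedBall_zero_iff, not_le] at hpR
      have hsame := hf.sameAcross_sub hg huv huD huD (hMN _ hin) _ _ hz hz'
      exact Or.inl ⟨by linarith,
        exists_mem_face_lt_norm (hz'.segment_subset huv.symm hp) hpR⟩

lemma IsNormalizedHeight.eq_annulus {h : G.Config → ℂ → ℝ} (hn : G.IsNormalizedHeight ref D h)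
    (hD : G.CoversDisc D R) (hR : 0 ≤ R) (h0 : G.IsFaceOf D 0) (hM : G.IsDimer D M)
    (hN : G.IsDimer D N) (hMN : ∀ e, e ∉ G.edgesInside R → (e ∈ N ↔ e ∈ M)) {y : ℂ}
    (hy : ‖y‖ ∈ Set.Ioo R (R + 1)) (hys : y ∉ G.skeleton) : h N y = h M y := by
  have hf := hn.1 M hM
  have hg := hn.1 N hN
  obtain ⟨b, hb, hpath, hfix⟩ := hn.2 0 h0
  obtain ⟨y', hy', hys', heq⟩ :
      ∃ y, ‖y‖ ∈ Set.Ioo R (R + 1) ∧ y ∉ G.skeleton ∧ h N y = h M y := by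
    refine (hf.eq_or_exists_eq_annulus hg hD hMN hb (hfix N M hN hM)
      (reflTransGen_adjacentFaces_symm hpath)).elim (fun ⟨heq, q, hq, hqR⟩ => ?_) id
    exact hf.exists_eq_annulus hg heq (subset_closure (mem_face_self h0.1))
      (by rw [norm_zero]; linarith) hq hqR
  linarith [hf.sub_eq_sub_annulus hg hD hR hMN hy hy' hys hys']

/-- On the whole plane no normalization is available: only height increments are compared. -/
lemma IsHeight.sub_eq_sub_ball (hf : G.IsHeight ref D M f) (hg : G.IsHeight ref Set.univ N g)
    (hD : G.CoversDisc D R) (hMN : ∀ e ∈ G.edgesMeeting (R + 1), (e ∈ M ↔ e ∈ N)) {y y' : ℂ}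
    (hy : ‖y‖ < R + 1) (hy' : ‖y'‖ < R + 1) (hys : y ∉ G.skeleton) (hys' : y' ∉ G.skeleton) :
    g y - g y' = f y - f y' := by
  have hconst := hf.sub_eq_sub_of_isOpen hg (convex_ball (0 : ℂ) (R + 1)).isPreconnected
    Metric.isOpen_ball (fun e ⟨p, hp, hpR⟩ => ?_) (mem_ball_zero_iff.2 hy)
    (mem_ball_zero_iff.2 hy') hys hys'
  · linarith
  · have hmeet : e ∈ G.edgesMeeting (R + 1) := ⟨p, hp, Metric.ball_subset_closedBall hpR⟩
    exact ⟨fun v hv => ⟨hD.edge e hmeet v hv, Set.mem_univ v⟩, (hMN e hmeet).symm⟩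

end IsHeight

/-! ### Boltzmann measures -/

variable (G) in
lemma countable_edge : Countable G.Edge := by
  rw [← Set.countable_univ_iff]
  refine (Set.countable_iUnion fun n : ℕ => (G.finite_edgesMeeting n).countable).mono fun e _ => ?_
  obtain ⟨u, v, h, rfl⟩ := exists_adj_eq_mk e
  obtain ⟨n, hn⟩ := exists_nat_ge ‖G.pos u‖
  exact Set.mem_iUnion.2 ⟨n, mem_edgesMeeting_of_mem (Sym2.mem_mk_left u v) hn⟩

section Boltzmann

variable {S T E E' : Set G.Config} {wt wt' : G.Config → ℝ}

lemma boltzmann_eq (hS : S.Finite) (wt : G.Config → ℝ) :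
    G.boltzmann S wt = (ENNReal.ofReal (∑ M ∈ hS.toFinset, wt M))⁻¹ •
      ∑ M ∈ hS.toFinset, ENNReal.ofReal (wt M) • Measure.dirac M := by
  have := hS.fintype
  rw [boltzmann, finsum_mem_eq_finite_toFinset_sum _ hS, Measure.sum_fintype,
    ← Finset.sum_subtype (p := (· ∈ S)) hS.toFinset (fun _ => hS.mem_toFinset)
      fun M => ENNReal.ofReal (wt M) • Measure.dirac M]

lemma boltzmann_real (hS : S.Finite) (hwt : ∀ M, 0 < wt M) (E : Set G.Config) :
    (G.boltzmann S wt).real E =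
      (∑ M ∈ hS.toFinset, E.indicator wt M) / ∑ M ∈ hS.toFinset, wt M := by
  have := G.countable_edge
  have hdirac : ∀ M, (ENNReal.ofReal (wt M) • Measure.dirac M) E =
      ENNReal.ofReal (E.indicator wt M) := fun M => by
    rw [Measure.smul_apply, Measure.dirac_apply, smul_eq_mul]
    by_cases hM : M ∈ E <;> simp [hM]
  have hsum : 0 ≤ ∑ M ∈ hS.toFinset, wt M := Finset.sum_nonneg fun M _ => (hwt M).le
  have hind : ∀ M ∈ hS.toFinset, 0 ≤ E.indicator wt M := fun M _ =>
    Set.indicator_nonneg (fun M _ => (hwt M).le) M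
  rw [boltzmann_eq hS, measureReal_def, Measure.smul_apply, Measure.finsetSum_apply,
    Finset.sum_congr rfl fun M _ => hdirac M, ← ENNReal.ofReal_sum_of_nonneg hind, smul_eq_mul,
    ENNReal.toReal_mul, ENNReal.toReal_inv, ENNReal.toReal_ofReal hsum,
    ENNReal.toReal_ofReal (Finset.sum_nonneg hind), div_eq_inv_mul]

lemma integral_boltzmann (hS : S.Finite) (hwt : ∀ M, 0 < wt M) (F : G.Config → ℝ) :
    ∫ M, F M ∂(G.boltzmann S wt) =
      (∑ M ∈ hS.toFinset, wt M * F M) / ∑ M ∈ hS.toFinset, wt M := by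
  have := G.countable_edge
  have hsum : 0 ≤ ∑ M ∈ hS.toFinset, wt M := Finset.sum_nonneg fun M _ => (hwt M).le
  have hdirac : ∀ M, ∫ N, F N ∂(ENNReal.ofReal (wt M) • Measure.dirac M) = wt M * F M := fun M => by
    rw [integral_smul_measure, integral_dirac, ENNReal.toReal_ofReal (hwt M).le, smul_eq_mul]
  rw [boltzmann_eq hS, integral_smul_measure, integral_finsetSum_measure fun M _ =>
      (integrable_dirac enorm_lt_top).smul_measure ENNReal.ofReal_ne_top,
    Finset.sum_congr rfl fun M _ => hdirac M, ENNReal.toReal_inv, ENNReal.toReal_ofReal hsum,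
    smul_eq_mul, div_eq_inv_mul]

lemma sum_weight_pos (hS : S.Finite) (hne : S.Nonempty) (hwt : ∀ M, 0 < wt M) :
    0 < ∑ M ∈ hS.toFinset, wt M :=
  Finset.sum_pos (fun M _ => hwt M) (hS.toFinset_nonempty.2 hne)

lemma isProbabilityMeasure_boltzmann (hS : S.Finite) (hne : S.Nonempty) (hwt : ∀ M, 0 < wt M) :
    IsProbabilityMeasure (G.boltzmann S wt) := by
  have huniv := boltzmann_real hS hwt Set.univ
  rw [Set.indicator_univ, div_self (sum_weight_pos hS hne hwt).ne', measureReal_def,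
    ENNReal.toReal_eq_one_iff] at huniv
  exact ⟨huniv⟩

lemma boltzmann_real_le_iff (hS : S.Finite) (hne : S.Nonempty) (hwt : ∀ M, 0 < wt M) {δ : ℝ} :
    (G.boltzmann S wt).real E ≤ δ ↔
      ∑ M ∈ hS.toFinset, E.indicator wt M ≤ δ * ∑ M ∈ hS.toFinset, wt M := by
  rw [boltzmann_real hS hwt, div_le_iff₀ (sum_weight_pos hS hne hwt)]

lemma boltzmann_real_mono (hS : S.Finite) (hwt : ∀ M, 0 < wt M)
    (hE : ∀ M ∈ S, M ∈ E → M ∈ E') :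
    (G.boltzmann S wt).real E ≤ (G.boltzmann S wt).real E' := by
  rw [boltzmann_real hS hwt, boltzmann_real hS hwt]
  refine div_le_div_of_nonneg_right (Finset.sum_le_sum fun M hM => ?_)
    (Finset.sum_nonneg fun M _ => (hwt M).le)
  exact Set.indicator_apply_le'
    (fun hME => (Set.indicator_of_mem (hE M (hS.mem_toFinset.1 hM) hME) wt).ge)
    fun _ => Set.indicator_nonneg (fun M _ => (hwt M).le) M

lemma boltzmann_real_of_bijOn (hS : S.Finite) (hwt : ∀ M, 0 < wt M) (hwt' : ∀ M, 0 < wt' M)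
    {f : G.Config → G.Config} (hf : Set.BijOn f S T) (hfwt : ∀ M ∈ S, wt' (f M) = wt M) :
    (G.boltzmann T wt').real E = (G.boltzmann S wt).real (f ⁻¹' E) := by
  classical
  have hT : T.Finite := hf.finite_iff_finite.1 hS
  have hsum : ∀ g : G.Config → ℝ, ∑ N ∈ hT.toFinset, g N = ∑ M ∈ hS.toFinset, g (f M) := fun g =>
    (Finset.sum_nbij f (fun M hM => hT.mem_toFinset.2 (hf.mapsTo (hS.mem_toFinset.1 hM)))
      (by simpa using hf.injOn) (by simpa using hf.surjOn) fun _ _ => rfl).symm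
  rw [boltzmann_real hS hwt, boltzmann_real hT hwt', hsum, hsum]
  congr 1
  · refine Finset.sum_congr rfl fun M hM => ?_
    simp only [Set.indicator_apply, Set.mem_preimage, hfwt M (hS.mem_toFinset.1 hM)]
  · exact Finset.sum_congr rfl fun M hM => hfwt M (hS.mem_toFinset.1 hM)

lemma boltzmann_real_const_mul (hS : S.Finite) (hwt : ∀ M, 0 < wt M) (hwt' : ∀ M, 0 < wt' M)
    {c : ℝ} (hc : c ≠ 0) (h : ∀ M ∈ S, wt' M = c * wt M) (E : Set G.Config) :
    (G.boltzmann S wt').real E = (G.boltzmann S wt).real E := by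
  have hind : ∀ M ∈ hS.toFinset, E.indicator wt' M = c * E.indicator wt M := fun M hM => by
    by_cases hME : M ∈ E
    · simpa only [Set.indicator_of_mem hME] using h M (hS.mem_toFinset.1 hM)
    · simp only [Set.indicator_of_notMem hME, mul_zero]
  rw [boltzmann_real hS hwt, boltzmann_real hS hwt', Finset.sum_congr rfl hind, ← Finset.mul_sum,
    Finset.sum_congr rfl fun M hM => h M (hS.mem_toFinset.1 hM), ← Finset.mul_sum,
    mul_div_mul_left _ _ hc]

lemma boltzmann_real_le_of_fiber (hS : S.Finite) (hwt : ∀ M, 0 < wt M) {β : Type*}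
    (κ : G.Config → β) {δ : ℝ} (hδ : 0 ≤ δ)
    (h : ∀ M ∈ S, M ∈ E → (G.boltzmann {N ∈ S | κ N = κ M} wt).real E ≤ δ) :
    (G.boltzmann S wt).real E ≤ δ := by
  classical
  rcases S.eq_empty_or_nonempty with rfl | hne
  · rw [boltzmann_real hS hwt]
    simpa using hδ
  have hmaps : ∀ M ∈ hS.toFinset, κ M ∈ hS.toFinset.image κ := fun M hM =>
    Finset.mem_image_of_mem κ hM
  rw [boltzmann_real_le_iff hS hne hwt, ← Finset.sum_fiberwise_of_maps_to hmaps,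
    ← Finset.sum_fiberwise_of_maps_to hmaps, Finset.mul_sum]
  refine Finset.sum_le_sum fun c _ => ?_
  by_cases hex : ∃ M ∈ S, κ M = c ∧ M ∈ E
  · obtain ⟨M, hM, rfl, hME⟩ := hex
    have hfib : {N ∈ S | κ N = κ M}.Finite := hS.subset (Set.sep_subset S _)
    convert (boltzmann_real_le_iff hfib ⟨M, hM, rfl⟩ hwt).1 (h M hM hME) using 3 <;>
      · ext N
        simp
  · rw [Finset.sum_eq_zero fun N hN => ?_]
    · exact mul_nonneg hδ (Finset.sum_nonneg fun M _ => (hwt M).le)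
    · rw [Finset.mem_filter, hS.mem_toFinset] at hN
      exact Set.indicator_of_notMem (fun hNE => hex ⟨N, hN.1, hN.2, hNE⟩) _

end Boltzmann

/-! ### The law inside a disc given the configuration outside -/

variable (G) in
lemma finite_edges_within (D : Finset V) : {e : G.Edge | ∀ v ∈ e.1, v ∈ D}.Finite :=
  (D.sym2.finite_toSet.preimage Subtype.val_injective.injOn).subset
    fun _ he => Finset.mem_sym2_iff.2 he

lemma IsDimer.finite {D : Finset V} {M : G.Config} (hM : G.IsDimer (D : Set V) M) : M.Finite :=
  (G.finite_edges_within D).subset hM.1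

variable (G) in
lemma finite_isDimer (D : Finset V) : {M | G.IsDimer (D : Set V) M}.Finite :=
  (G.finite_edges_within D).finite_subsets.subset fun _ hM => hM.1

variable (G) in
/-- The weight of a configuration: the product of the weights of its edges. It is only meaningful
for finite configurations, since `∏ᶠ` gives `1` otherwise. -/
noncomputable def configWeight (M : G.Config) : ℝ := ∏ᶠ e ∈ M, G.weight e

lemma configWeight_pos (M : G.Config) : 0 < G.configWeight M :=
  finprod_mem_induction (0 < ·) one_pos (fun _ _ => mul_pos) fun e _ => G.weight_pos e

lemma configWeight_inter_mul_sdiff {M : G.Config} (hM : M.Finite) (A : Set G.Edge) :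
    G.configWeight (M ∩ A) * G.configWeight (M \ A) = G.configWeight M :=
  finprod_mem_inter_mul_sdiff A hM

lemma norm_pos_le_of_mem_edgesInside {R : ℝ} {e : G.Edge} (he : e ∈ G.edgesInside R) {v : V}
    (hv : v ∈ e.1) : ‖G.pos v‖ ≤ R :=
  mem_closedBall_zero_iff.1 (he (pos_mem_edgeSegment hv))

variable (G) in
lemma finite_edgesInside (R : ℝ) : (G.edgesInside R).Finite := by
  refine (G.finite_edgesMeeting R).subset fun e he => ?_
  obtain ⟨u, v, h, rfl⟩ := exists_adj_eq_mk e
  exact mem_edgesMeeting_of_mem (Sym2.mem_mk_left u v)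
    (norm_pos_le_of_mem_edgesInside he (Sym2.mem_mk_left u v))

variable (G) in
/-- The dimer configurations on `D` which agree with `M` outside the disc of radius `R`. -/
def resamplings (D : Set V) (R : ℝ) (M : G.Config) : Set G.Config :=
  {N | G.IsDimer D N ∧ ∀ e, e ∉ G.edgesInside R → (e ∈ N ↔ e ∈ M)}

variable (G) in
/-- The analogue of `specification` on a domain: the law of a dimer configuration on `D` given that
it agrees with `M` outside the disc of radius `R`. -/
noncomputable def conditionalLaw (D : Set V) (R : ℝ) (M : G.Config) : Measure G.Config :=
  G.boltzmann (G.resamplings D R M) fun N => G.configWeight (N ∩ G.edgesInside R)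

section Resampling

variable {D D' : Set V} {R : ℝ} {M M' N : G.Config}

lemma self_mem_resamplings (hM : G.IsDimer D M) : M ∈ G.resamplings D R M :=
  ⟨hM, fun _ _ => Iff.rfl⟩

lemma finite_resamplings (D : Set V) (R : ℝ) (M : G.Config) : (G.resamplings D R M).Finite := by
  refine ((G.finite_edgesInside R).finite_subsets.image
    fun J => J ∪ M \ G.edgesInside R).subset fun N hN => ?_
  refine ⟨N ∩ G.edgesInside R, Set.inter_subset_right, ?_⟩
  ext e
  by_cases he : e ∈ G.edgesInside R
  · simp [he]
  · simp [he, hN.2 e he]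

lemma ite_mem_resamplings (hM : G.IsDimer D M) (hD : ∀ v, ‖G.pos v‖ ≤ R → v ∈ D)
    (hD' : ∀ v, ‖G.pos v‖ ≤ R → v ∈ D') (hMM' : ∀ e ∈ G.edgesMeeting R, (e ∈ M ↔ e ∈ M'))
    (hN : N ∈ G.resamplings D' R M') : (G.edgesInside R).ite N M ∈ G.resamplings D R M := by
  refine ⟨hM.ite hN.1 (fun e he v hv => ?_) fun x e he f hf hxe hxf => ?_,
    fun e he => mem_ite_of_notMem he⟩
  · have hvR := norm_pos_le_of_mem_edgesInside he hv
    exact ⟨hD v hvR, hD' v hvR⟩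
  by_contra hne
  have hx : ‖G.pos x‖ ≤ R := by
    by_cases heR : e ∈ G.edgesInside R
    · exact norm_pos_le_of_mem_edgesInside heR hxe
    · exact norm_pos_le_of_mem_edgesInside (by tauto) hxf
  refine hne (iff_of_eq (congrArg (· ∈ G.edgesInside R) ?_))
  by_cases hfR : f ∈ G.edgesInside R
  · have heR : e ∉ G.edgesInside R := fun heR => hne (iff_of_true heR hfR)
    have heN : e ∈ N := (hN.2 e heR).2 ((hMM' e (mem_edgesMeeting_of_mem hxe hx)).1 he)
    exact hN.1.eq_of_mem (hD' x hx) heN hf hxe hxf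
  · have hfM : f ∈ M := (hMM' f (mem_edgesMeeting_of_mem hxf hx)).2 ((hN.2 f hfR).1 hf)
    exact hM.eq_of_mem (hD x hx) he hfM hxe hxf

lemma bijOn_ite_resamplings (hM : G.IsDimer D M) (hM' : G.IsDimer D' M')
    (hD : ∀ v, ‖G.pos v‖ ≤ R → v ∈ D) (hD' : ∀ v, ‖G.pos v‖ ≤ R → v ∈ D')
    (hMM' : ∀ e ∈ G.edgesMeeting R, (e ∈ M ↔ e ∈ M')) :
    Set.BijOn ((G.edgesInside R).ite · M') (G.resamplings D R M) (G.resamplings D' R M') := by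
  have hinv : ∀ {D M M' N}, N ∈ G.resamplings D R M →
      (G.edgesInside R).ite ((G.edgesInside R).ite N M') M = N := fun hN => by
    ext e
    by_cases he : e ∈ G.edgesInside R
    · rw [mem_ite_of_mem he, mem_ite_of_mem he]
    · rw [mem_ite_of_notMem he, hN.2 e he]
  exact Set.InvOn.bijOn (f' := ((G.edgesInside R).ite · M))
    ⟨fun N hN => hinv hN, fun N hN => hinv hN⟩
    (fun N hN => ite_mem_resamplings hM' hD' hD (fun e he => (hMM' e he).symm) hN)
    (fun N hN => ite_mem_resamplings hM hD hD' hMM' hN)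

lemma conditionalLaw_real_preimage_ite (hM : G.IsDimer D M) (hM' : G.IsDimer D' M')
    (hD : ∀ v, ‖G.pos v‖ ≤ R → v ∈ D) (hD' : ∀ v, ‖G.pos v‖ ≤ R → v ∈ D')
    (hMM' : ∀ e ∈ G.edgesMeeting R, (e ∈ M ↔ e ∈ M')) (E : Set G.Config) :
    (G.conditionalLaw D R M).real (((G.edgesInside R).ite · M') ⁻¹' E) =
      (G.conditionalLaw D' R M').real E :=
  (boltzmann_real_of_bijOn (finite_resamplings D R M) (fun _ => configWeight_pos _)
    (fun _ => configWeight_pos _) (bijOn_ite_resamplings hM hM' hD hD' hMM')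
    fun N _ => by rw [Set.ite_inter_self]).symm

end Resampling

lemma boltzmann_resamplings_real {D : Finset V} {R : ℝ} {M : G.Config} (E : Set G.Config) :
    (G.boltzmann (G.resamplings D R M) G.configWeight).real E =
      (G.conditionalLaw D R M).real E := by
  refine boltzmann_real_const_mul (finite_resamplings _ R M) (fun _ => configWeight_pos _)
    configWeight_pos (configWeight_pos (M \ G.edgesInside R)).ne' (fun N hN => ?_) E
  have hsdiff : M \ G.edgesInside R = N \ G.edgesInside R := by
    ext e
    exact and_congr_left fun he => (hN.2 e he).symm
  rw [hsdiff, mul_comm, configWeight_inter_mul_sdiff hN.1.finite]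

lemma dimerMeasure_real_le_of_conditionalLaw {D : Finset V} {R δ : ℝ} (hδ : 0 ≤ δ)
    {E : Set G.Config} (h : ∀ M, G.IsDimer (D : Set V) M → M ∈ E →
      (G.conditionalLaw D R M).real E ≤ δ) :
    (G.dimerMeasure D).real E ≤ δ := by
  refine boltzmann_real_le_of_fiber (G.finite_isDimer D) configWeight_pos
    (fun M => M \ G.edgesInside R) hδ fun M hM hME => ?_
  have hfiber : {N ∈ {N | G.IsDimer (D : Set V) N} |
      N \ G.edgesInside R = M \ G.edgesInside R} = G.resamplings D R M := by
    ext N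
    simp only [resamplings, Set.mem_ofPred_eq, Set.ext_iff, Set.mem_sdiff, and_congr_left_iff]
  rw [hfiber, boltzmann_resamplings_real]
  exact h M hM hME

/-! ### Local observables -/

/-- `f M` is determined by the edges of `M` in `W`. -/
def DependsOnEdges {α : Type*} (W : Set G.Edge) (f : G.Config → α) : Prop :=
  ∀ M N : G.Config, (∀ e ∈ W, (e ∈ M ↔ e ∈ N)) → f M = f N

lemma dependsOnEdges_inter {α : Type*} (W : Set G.Edge) (f : G.Config → α) :
    DependsOnEdges W fun M => f (M ∩ W) := fun _ _ h =>
  congrArg f (Set.ext fun e => and_congr_left (h e))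

section Finite

variable {W : Set G.Edge} (hW : W.Finite)
include hW

lemma measurableSet_of_dependsOnEdges {A : Set G.Config} (hA : DependsOnEdges W (· ∈ A)) :
    MeasurableSet A := by
  have := G.countable_edge
  have hcylinders : A = ⋃ J ∈ {J ∈ W.powerset | J ∈ A}, ⋂ e ∈ W, {M | e ∈ M ↔ e ∈ J} := by
    ext M
    simp only [Set.mem_iUnion, Set.mem_iInter, exists_prop]
    refine ⟨fun hM => ?_, fun ⟨J, hJ, hMJ⟩ => (hA M J hMJ).mpr hJ.2⟩
    have hMW : ∀ e ∈ W, (e ∈ M ↔ e ∈ M ∩ W) := fun e he => (and_iff_left he).symm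
    exact ⟨M ∩ W, ⟨Set.inter_subset_right, (hA M _ hMW).mp hM⟩, hMW⟩
  rw [hcylinders]
  refine (hW.finite_subsets.subset (Set.sep_subset _ _)).measurableSet_biUnion fun J _ =>
    hW.measurableSet_biInter fun e _ => ?_
  by_cases heJ : e ∈ J
  · simpa [heJ] using measurableSet_mem e
  · simpa [heJ] using measurableSet_notMem e

lemma measurable_of_dependsOnEdges {F : G.Config → ℝ} (hF : DependsOnEdges W F) : Measurable F :=
  fun B _ => measurableSet_of_dependsOnEdges hW fun M N hMN =>
    congrArg (· ∈ B) (hF M N hMN)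

end Finite

section Distance

variable {M N : G.Config} {R : ℝ}

lemma drawing_inter_ball_subset (h : ∀ e ∈ G.edgesMeeting R, e ∈ M → e ∈ N) :
    G.drawing M ∩ Metric.ball 0 R ⊆ G.drawing N ∩ Metric.ball 0 R := by
  rintro z ⟨hz, hzR⟩
  obtain ⟨e, he, hze⟩ := Set.mem_iUnion₂.1 hz
  exact ⟨Set.mem_biUnion (h e ⟨z, hze, Metric.ball_subset_closedBall hzR⟩ he) hze, hzR⟩

lemma localDist_le_exp_neg (hR : 0 ≤ R) (h : ∀ e ∈ G.edgesMeeting R, (e ∈ M ↔ e ∈ N)) :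
    G.localDist M N ≤ Real.exp (-R) := by
  refine csInf_le ⟨0, ?_⟩ ⟨R, hR, rfl, (drawing_inter_ball_subset fun e he => (h e he).1).antisymm
    (drawing_inter_ball_subset fun e he => (h e he).2)⟩
  rintro _ ⟨R', -, rfl, -⟩
  exact (Real.exp_pos _).le

/-- The midpoint of an edge lies on no other edge, so that the drawing determines the edges. -/
lemma midpoint_mem_drawing_iff {u v : V} (huv : G.graph.Adj u v) :
    G.chart u v (1 / 2 : ℝ) ∈ G.drawing M ↔ ⟨s(u, v), huv⟩ ∈ M := by
  have hhalf : (1 / 2 : ℝ) ∈ Set.Ioo (0 : ℝ) 1 := by constructor <;> norm_num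
  constructor
  · intro hmid
    obtain ⟨e, he, hmid⟩ := Set.mem_iUnion₂.1 hmid
    rwa [eq_mk_of_chart_mem_edgeSegment huv hhalf hmid] at he
  · intro he
    refine Set.mem_biUnion he ?_
    rw [edgeSegment_mk]
    exact mem_segment_iff_chart.2 ⟨1 / 2, Set.Ioo_subset_Icc_self hhalf, rfl⟩

lemma drawing_inter_ball_eq_of_localDist_lt (h : G.localDist M N < Real.exp (-R)) :
    G.drawing M ∩ Metric.closedBall 0 R = G.drawing N ∩ Metric.closedBall 0 R := by
  obtain ⟨_, ⟨R', -, rfl, hdraw⟩, hlt⟩ := exists_lt_of_csInf_lt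
    ⟨Real.exp (-0), by exact ⟨0, le_rfl, rfl, by simp only [Metric.ball_zero, Set.inter_empty]⟩⟩ h
  have hsub : Metric.closedBall (0 : ℂ) R ⊆ Metric.ball 0 R' :=
    Metric.closedBall_subset_ball (neg_lt_neg_iff.1 (Real.exp_lt_exp.1 hlt))
  rw [← Set.inter_eq_self_of_subset_right hsub, ← Set.inter_assoc, hdraw, Set.inter_assoc]

lemma exists_forall_localDist_lt_mem_iff {W : Set G.Edge} (hW : W.Finite) :
    ∃ δ > 0, ∀ M N : G.Config, G.localDist M N < δ → ∀ e ∈ W, (e ∈ M ↔ e ∈ N) := by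
  induction W, hW using Set.Finite.induction_on with
  | empty => exact ⟨1, one_pos, fun _ _ _ e he => he.elim⟩
  | @insert e W _ _ ih =>
    obtain ⟨δ, hδ, hW⟩ := ih
    obtain ⟨u, v, huv, rfl⟩ := exists_adj_eq_mk e
    refine ⟨min δ (Real.exp (-‖G.chart u v (1 / 2 : ℝ)‖)), lt_min hδ (Real.exp_pos _),
      fun M N hMN => ?_⟩
    rw [lt_min_iff] at hMN
    refine Set.forall_mem_insert.2 ⟨?_, hW M N hMN.1⟩
    have hmid := Set.ext_iff.1 (drawing_inter_ball_eq_of_localDist_lt hMN.2)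
      (G.chart u v (1 / 2 : ℝ))
    rw [← midpoint_mem_drawing_iff, ← midpoint_mem_drawing_iff]
    simpa only [Set.mem_inter_iff, mem_closedBall_zero_iff, le_refl, and_true] using hmid

end Distance

/-- Continuity for the local distance, in the form used by `LocallyConverges`. -/
def LocallyContinuous (F : G.Config → ℝ) : Prop :=
  ∀ M, ∀ ε > 0, ∃ δ > 0, ∀ N, G.localDist M N < δ → |F N - F M| < ε

lemma locallyContinuous_of_dependsOnEdges {W : Set G.Edge} (hW : W.Finite) {F : G.Config → ℝ}
    (hF : DependsOnEdges W F) : LocallyContinuous F := by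
  obtain ⟨δ, hδ, hagree⟩ := exists_forall_localDist_lt_mem_iff hW
  refine fun M ε hε => ⟨δ, hδ, fun N hN => ?_⟩
  rwa [hF M N (hagree M N hN), sub_self, abs_zero]

/-- The limit consists of the edges that belong to most configurations of the sequence. -/
lemma exists_ultrafilter_limit (U : Ultrafilter ℕ) (M : ℕ → G.Config) :
    ∃ L : G.Config, ∀ δ > 0, ∃ R : ℕ, ∀ᶠ k in U, ∀ N : G.Config,
      (∀ e ∈ G.edgesMeeting R, (e ∈ N ↔ e ∈ M k)) → G.localDist L N < δ := by
  refine ⟨{e | ∀ᶠ k in U, e ∈ M k}, fun δ hδ => ?_⟩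
  obtain ⟨R, hR⟩ : ∃ R : ℕ, Real.exp (-R) < δ :=
    ((Real.tendsto_exp_neg_atTop_nhds_zero.comp tendsto_natCast_atTop_atTop).eventually
      (gt_mem_nhds hδ)).exists
  have hagree : ∀ᶠ k in U, ∀ e ∈ G.edgesMeeting R, ((∀ᶠ j in U, e ∈ M j) ↔ e ∈ M k) := by
    refine (eventually_all_finite (finite_edgesMeeting R)).2 fun e _ => ?_
    by_cases he : ∀ᶠ j in U, e ∈ M j
    · exact he.mono fun k hk => iff_of_true he hk
    · exact (Ultrafilter.eventually_not.2 he).mono fun k hk => iff_of_false he hk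
  refine ⟨R, hagree.mono fun k hk N hN => ?_⟩
  exact (localDist_le_exp_neg R.cast_nonneg fun e he =>
    (hk e he).trans (hN e he).symm).trans_lt hR

namespace LocallyContinuous

variable {F : G.Config → ℝ} (hF : LocallyContinuous F)
include hF

/-- Compactness of the space of configurations turns continuity into uniform continuity. -/
lemma exists_forall_abs_sub_lt {η : ℝ} (hη : 0 < η) : ∃ k : ℕ, ∀ M N : G.Config,
    (∀ e ∈ G.edgesMeeting k, (e ∈ M ↔ e ∈ N)) → |F M - F N| < η := by
  by_contra! hcon
  choose M N hagree hge using hcon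
  obtain ⟨L, hL⟩ := exists_ultrafilter_limit (hyperfilter ℕ) M
  obtain ⟨δ, hδ, hclose⟩ := hF L (η / 2) (by linarith)
  obtain ⟨R, hR⟩ := hL δ hδ
  have hlarge : ∀ᶠ k in (hyperfilter ℕ : Filter ℕ), R ≤ k :=
    (eventually_ge_atTop R).filter_mono Nat.hyperfilter_le_atTop
  obtain ⟨k, hk, hRk⟩ := (hR.and hlarge).exists
  have hM := hclose (M k) (hk (M k) fun _ _ => Iff.rfl)
  have hN := hclose (N k) (hk (N k) fun e he =>
    (hagree k e (edgesMeeting_mono (Nat.cast_le.2 hRk) he)).symm)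
  rw [abs_sub_comm] at hN
  linarith [hge k, abs_sub_le (F (M k)) (F L) (F (N k))]

lemma exists_forall_abs_sub_inter_lt {η : ℝ} (hη : 0 < η) : ∃ k : ℕ, ∀ j ≥ k, ∀ M : G.Config,
    |F M - F (M ∩ G.edgesMeeting j)| < η := by
  obtain ⟨k, hk⟩ := hF.exists_forall_abs_sub_lt hη
  exact ⟨k, fun j hj M => hk _ _ fun e he =>
    (and_iff_left (edgesMeeting_mono (Nat.cast_le.2 hj) he)).symm⟩

lemma measurable : Measurable F := by
  refine measurable_of_tendsto_metrizable (f := fun (k : ℕ) M => F (M ∩ G.edgesMeeting k))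
    (fun k => measurable_of_dependsOnEdges (finite_edgesMeeting k) (dependsOnEdges_inter _ F))
    (tendsto_pi_nhds.2 fun M => Metric.tendsto_atTop.2 fun η hη => ?_)
  obtain ⟨k, hk⟩ := hF.exists_forall_abs_sub_inter_lt hη
  exact ⟨k, fun j hj => by simpa only [dist_comm, Real.dist_eq] using hk j hj M⟩

end LocallyContinuous

/-! ### Spread-out heights -/

variable (G) in
/-- The event in the definition of `SpreadOut`: given the configuration `m` outside the disc of
radius `R`, the height at the origin is in every interval of length one with probability at most
`ε`. -/
def SpreadAt (ref : G.Edge → ℝ) (R ε : ℝ) (m : G.Config) : Prop :=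
  ∀ z, z ∉ G.skeleton → R < ‖z‖ → ∀ x : ℝ,
    (G.specification R m).real {M | ∀ H, G.IsHeight ref Set.univ M H →
      H 0 - H z ∈ Set.Ioo x (x + 1)} ≤ ε

lemma SpreadAt.norm_le_of_mem_face {ref : G.Edge → ℝ} {R ε : ℝ} {m : G.Config}
    (h : G.SpreadAt ref R ε m) (hm : G.IsDimer Set.univ m) (hε : ε < 1) {z : ℂ}
    (hz : z ∈ G.face 0) : ‖z‖ ≤ R := by
  by_contra! hlt
  have : IsProbabilityMeasure (G.specification R m) :=
    isProbabilityMeasure_boltzmann (finite_resamplings Set.univ R m)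
      ⟨m, self_mem_resamplings hm⟩ fun _ => configWeight_pos _
  have huniv : {M : G.Config | ∀ H, G.IsHeight ref Set.univ M H →
      H 0 - H z ∈ Set.Ioo (-1 / 2 : ℝ) (-1 / 2 + 1)} = Set.univ := by
    refine Set.eq_univ_of_forall fun M H hH => ?_
    rw [hH.1 0 z hz, sub_self]
    constructor <;> norm_num
  have hle := h z (notMem_skeleton_of_mem_face hz) hlt (-1 / 2)
  rw [huniv, probReal_univ] at hle
  linarith

variable (G) in
/-- The edges that share an endpoint with an edge meeting the disc of radius `R + 1`. A dimer
configuration on a domain which coincides with one of the whole graph on these edges covers the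
disc, see `IsSpreadNear.coversDisc`. -/
def edgesNear (R : ℝ) : Set G.Edge :=
  {e | ∃ f ∈ G.edgesMeeting (R + 1), ∃ v ∈ f.1, v ∈ e.1}

lemma edgesMeeting_subset_edgesNear (R : ℝ) : G.edgesMeeting (R + 1) ⊆ G.edgesNear R :=
  fun e he => by
    obtain ⟨u, v, h, rfl⟩ := exists_adj_eq_mk e
    exact ⟨_, he, u, Sym2.mem_mk_left u v, Sym2.mem_mk_left u v⟩

lemma finite_edgesNear (R : ℝ) : (G.edgesNear R).Finite := by
  have hbiUnion : G.edgesNear R = ⋃ f ∈ G.edgesMeeting (R + 1), ⋃ v ∈ {v | v ∈ f.1},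
      {e | v ∈ e.1} := by
    ext e
    simp only [edgesNear, Set.mem_iUnion, Set.mem_ofPred_eq, exists_prop]
  rw [hbiUnion]
  refine (finite_edgesMeeting _).biUnion fun f _ => Set.Finite.biUnion ?_ fun v _ =>
    (finite_edgesMeeting ‖G.pos v‖).subset fun e he => mem_edgesMeeting_of_mem he le_rfl
  obtain ⟨u, v, h, rfl⟩ := exists_adj_eq_mk f
  exact (Set.toFinite {u, v}).subset fun x hx => Sym2.mem_iff.1 hx

/-- `M` agrees near the disc of radius `R` with a dimer configuration of the whole graph that
satisfies `SpreadAt`. Contrary to `SpreadAt` itself, this is a local event, and it makes sense on a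
domain. -/
def IsSpreadNear (ref : G.Edge → ℝ) (R ε : ℝ) (M : G.Config) : Prop :=
  ∃ m, G.IsDimer Set.univ m ∧ G.SpreadAt ref R ε m ∧ ∀ e ∈ G.edgesNear R, (e ∈ M ↔ e ∈ m)

lemma dependsOnEdges_isSpreadNear (ref : G.Edge → ℝ) (R ε : ℝ) :
    DependsOnEdges (G.edgesNear R) (IsSpreadNear ref R ε) := by
  have himp : ∀ M N : G.Config, (∀ e ∈ G.edgesNear R, (e ∈ M ↔ e ∈ N)) →
      IsSpreadNear ref R ε M → IsSpreadNear ref R ε N := fun M N h ⟨m, hm, hspread, hMm⟩ =>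
    ⟨m, hm, hspread, fun e he => (h e he).symm.trans (hMm e he)⟩
  exact fun M N h => propext ⟨himp M N h, himp N M fun e he => (h e he).symm⟩

/-- The windows advance by `1 / 2` since they are open: unit steps would miss their endpoints. -/
lemma exists_mem_window {a b L : ℝ} (h : |b - a| ≤ L) : ∃ j ∈ Finset.range (⌊4 * L⌋₊ + 1),
    b ∈ Set.Ioo (a - L - 1 / 2 + j / 2) (a - L - 1 / 2 + j / 2 + 1) := by
  rw [abs_le] at h
  have hnonneg : 0 ≤ 2 * (b - a + L) := by linarith
  refine ⟨⌊2 * (b - a + L)⌋₊, ?_, ?_, ?_⟩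
  · rw [Finset.mem_range, Nat.lt_succ_iff]
    exact Nat.floor_le_floor (by linarith)
  · linarith [Nat.floor_le hnonneg]
  · linarith [Nat.lt_floor_add_one (2 * (b - a + L))]

variable (G) in
lemma exists_mem_annulus_notMem_skeleton {R : ℝ} (hR : 0 ≤ R) :
    ∃ y, ‖y‖ ∈ Set.Ioo R (R + 1) ∧ y ∉ G.skeleton := by
  have hopen : IsOpen {y : ℂ | ‖y‖ ∈ Set.Ioo R (R + 1)} := isOpen_Ioo.preimage continuous_norm
  have hne : ((R + 1 / 2 : ℝ) : ℂ) ∈ {y : ℂ | ‖y‖ ∈ Set.Ioo R (R + 1)} := by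
    rw [Set.mem_ofPred_eq, Complex.norm_of_nonneg (by linarith)]
    constructor <;> linarith
  exact (dense_compl_skeleton (G := G)).inter_open_nonempty _ hopen ⟨_, hne⟩

namespace IsSpreadNear

variable {ref : G.Edge → ℝ} {R ε : ℝ} {M : G.Config} {D : Set V} {h : G.Config → ℂ → ℝ}
  (hspread : IsSpreadNear ref R ε M) (hM : G.IsDimer D M)
include hspread hM

lemma coversDisc : G.CoversDisc D R := by
  obtain ⟨m, hm, -, hMm⟩ := hspread
  have hmem : ∀ {v e}, v ∈ e.1 → e ∈ m → e ∈ G.edgesNear R → v ∈ D := fun hv he hnear =>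
    hM.1 _ ((hMm _ hnear).2 he) _ hv
  refine ⟨fun v hv => ?_, fun f hf v hv => ?_⟩ <;> obtain ⟨e, ⟨he, hve⟩, -⟩ := hm.2 v trivial
  · exact hmem hve he (edgesMeeting_subset_edgesNear R (mem_edgesMeeting_of_mem hve hv))
  · exact hmem hve he ⟨f, hf, v, hv, hve⟩

lemma mem_of_pos_mem_closure_face (hε : ε < 1) {v : V} (hv : G.pos v ∈ closure (G.face 0)) :
    v ∈ D := by
  refine (hspread.coversDisc hM).vertex v ?_
  obtain ⟨m, hm, hm_spread, -⟩ := hspread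
  have hball : closure (G.face 0) ⊆ Metric.closedBall 0 R := closure_minimal
    (fun z hz => mem_closedBall_zero_iff.2 (hm_spread.norm_le_of_mem_face hm hε hz))
    Metric.isClosed_closedBall
  linarith [mem_closedBall_zero_iff.1 (hball hv)]

/-- The conditional law on `D` is the image of the specification of the whole graph. -/
lemma conditionalLaw_real_increment_le (hn : G.IsNormalizedHeight ref D h)
    (h0 : (0 : ℂ) ∉ G.skeleton) (hR : 0 ≤ R) {y : ℂ} (hy : ‖y‖ ∈ Set.Ioo R (R + 1))
    (hys : y ∉ G.skeleton) (x : ℝ) :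
    (G.conditionalLaw D R M).real {N | h N 0 - h N y ∈ Set.Ioo x (x + 1)} ≤ ε := by
  have hD := hspread.coversDisc hM
  obtain ⟨m, hm, hm_spread, hMm⟩ := hspread
  have hagree : ∀ e ∈ G.edgesMeeting (R + 1), (e ∈ M ↔ e ∈ m) := fun e he =>
    hMm e (edgesMeeting_subset_edgesNear R he)
  set window : Set G.Config := {N | ∀ H, G.IsHeight ref Set.univ N H →
    H 0 - H y ∈ Set.Ioo x (x + 1)}
  calc (G.conditionalLaw D R M).real {N | h N 0 - h N y ∈ Set.Ioo x (x + 1)}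
    _ ≤ (G.conditionalLaw D R M).real (((G.edgesInside R).ite · m) ⁻¹' window) := by
        refine boltzmann_real_mono (finite_resamplings D R M) (fun _ => configWeight_pos _)
          fun N hN hNx H hH => ?_
        have hN_agree : ∀ e ∈ G.edgesMeeting (R + 1),
            (e ∈ N ↔ e ∈ (G.edgesInside R).ite N m) := fun e he => by
          by_cases heR : e ∈ G.edgesInside R
          · rw [mem_ite_of_mem heR]
          · rw [mem_ite_of_notMem heR, hN.2 e heR, hagree e he]
        rwa [(hn.1 N hN.1).sub_eq_sub_ball hH hD hN_agree (by rw [norm_zero]; linarith) hy.2 h0 hys]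
    _ = (G.specification R m).real window :=
        conditionalLaw_real_preimage_ite hM hm (fun v hv => hD.vertex v (by linarith))
          (fun v _ => Set.mem_univ v)
          (fun e he => hagree e (edgesMeeting_mono (by linarith) he)) _
    _ ≤ ε := hm_spread y hys hy.1 x

lemma conditionalLaw_real_near_le (hn : G.IsNormalizedHeight ref D h) (h0 : G.IsFaceOf D 0)
    (hR : 0 ≤ R) (t L : ℝ) :
    (G.conditionalLaw D R M).real {N | |t - h N 0| ≤ L} ≤ (⌊4 * L⌋₊ + 1) * ε := by
  obtain ⟨y, hy, hys⟩ := G.exists_mem_annulus_notMem_skeleton hR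
  set a : ℝ := t - h M y
  set window : ℕ → Set G.Config := fun j => {N | h N 0 - h N y ∈
    Set.Ioo (a - L - 1 / 2 + j / 2) (a - L - 1 / 2 + j / 2 + 1)}
  calc (G.conditionalLaw D R M).real {N | |t - h N 0| ≤ L}
    _ ≤ (G.conditionalLaw D R M).real (⋃ j ∈ Finset.range (⌊4 * L⌋₊ + 1), window j) := by
        refine boltzmann_real_mono (finite_resamplings D R M) (fun _ => configWeight_pos _)
          fun N hN hNt => Set.mem_iUnion₂.2 ?_
        have hNy : h N y = h M y :=
          hn.eq_annulus (hspread.coversDisc hM) hR h0 hM hN.1 hN.2 hy hys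
        have hNa : |h N 0 - h N y - a| ≤ L := by
          rw [hNy, abs_sub_comm, sub_sub_sub_cancel_right]
          exact hNt
        obtain ⟨j, hj, hmem⟩ := exists_mem_window hNa
        exact ⟨j, hj, hmem⟩
    _ ≤ ∑ j ∈ Finset.range (⌊4 * L⌋₊ + 1), (G.conditionalLaw D R M).real (window j) :=
        measureReal_biUnion_finset_le _ _
    _ ≤ ∑ _j ∈ Finset.range (⌊4 * L⌋₊ + 1), ε := Finset.sum_le_sum fun j _ =>
        hspread.conditionalLaw_real_increment_le hM hn h0.1 hR hy hys _
    _ = (⌊4 * L⌋₊ + 1) * ε := by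
        rw [Finset.sum_const, Finset.card_range, nsmul_eq_mul, Nat.cast_add, Nat.cast_one]

end IsSpreadNear

lemma dimerMeasure_real_isSpreadNear_inter_near_le {D : Finset V} {ref : G.Edge → ℝ}
    {h : G.Config → ℂ → ℝ} (hn : G.IsNormalizedHeight ref D h) (h0 : G.IsFaceOf (D : Set V) 0)
    {R ε : ℝ} (hR : 0 ≤ R) (hε : 0 ≤ ε) (t L : ℝ) :
    (G.dimerMeasure D).real {M | IsSpreadNear ref R ε M ∧ |t - h M 0| ≤ L} ≤
      (⌊4 * L⌋₊ + 1) * ε := by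
  refine dimerMeasure_real_le_of_conditionalLaw (R := R) (by positivity) fun M hM hMt => ?_
  calc (G.conditionalLaw D R M).real {N | IsSpreadNear ref R ε N ∧ |t - h N 0| ≤ L}
    _ ≤ (G.conditionalLaw D R M).real {N | |t - h N 0| ≤ L} :=
        boltzmann_real_mono (finite_resamplings D R M) (fun _ => configWeight_pos _)
          fun _ _ hN => hN.2
    _ ≤ (⌊4 * L⌋₊ + 1) * ε := hMt.1.conditionalLaw_real_near_le hM hn h0 hR t L

/-! ### Comparison of the dimer measures on two domains -/

section Boltzmann

variable {S S' : Set G.Config} {wt wt' : G.Config → ℝ}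

lemma integral_boltzmann_sub (hS : S.Finite) (hS' : S'.Finite) (hne : S.Nonempty)
    (hne' : S'.Nonempty) (hwt : ∀ M, 0 < wt M) (hwt' : ∀ M, 0 < wt' M) (F : G.Config → ℝ) :
    ∫ M, F M ∂(G.boltzmann S' wt') - ∫ M, F M ∂(G.boltzmann S wt) =
      (∑ p ∈ hS.toFinset ×ˢ hS'.toFinset, wt p.1 * wt' p.2 * (F p.2 - F p.1)) /
        ((∑ M ∈ hS.toFinset, wt M) * ∑ M ∈ hS'.toFinset, wt' M) := by
  have hprod : ∑ p ∈ hS.toFinset ×ˢ hS'.toFinset, wt p.1 * wt' p.2 * (F p.2 - F p.1) =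
      (∑ M ∈ hS.toFinset, wt M) * (∑ M' ∈ hS'.toFinset, wt' M' * F M') -
        (∑ M ∈ hS.toFinset, wt M * F M) * ∑ M' ∈ hS'.toFinset, wt' M' := by
    rw [Finset.sum_mul_sum, Finset.sum_mul_sum, ← Finset.sum_product', ← Finset.sum_product',
      ← Finset.sum_sub_distrib]
    exact Finset.sum_congr rfl fun p _ => by ring
  have hZ := sum_weight_pos hS hne hwt
  have hZ' := sum_weight_pos hS' hne' hwt'
  rw [integral_boltzmann hS hwt, integral_boltzmann hS' hwt', hprod]
  field_simp

open Classical in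
lemma sum_filter_not_le_of_boltzmann_real_le (hS : S.Finite) (hS' : S'.Finite) (hne : S.Nonempty)
    (hwt : ∀ M, 0 < wt M) (hwt' : ∀ M, 0 < wt' M) {r : G.Config → G.Config → Prop} {δ : ℝ}
    (hδ : ∀ M' ∈ S', (G.boltzmann S wt).real {M | ¬ r M M'} ≤ δ) :
    ∑ p ∈ hS.toFinset ×ˢ hS'.toFinset with ¬ r p.1 p.2, wt p.1 * wt' p.2 ≤
      δ * ((∑ M ∈ hS.toFinset, wt M) * ∑ M ∈ hS'.toFinset, wt' M) := by
  calc ∑ p ∈ hS.toFinset ×ˢ hS'.toFinset with ¬ r p.1 p.2, wt p.1 * wt' p.2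
    _ = ∑ M' ∈ hS'.toFinset, (∑ M ∈ hS.toFinset, {M | ¬ r M M'}.indicator wt M) * wt' M' := by
        rw [Finset.sum_filter, Finset.sum_product_right]
        refine Finset.sum_congr rfl fun M' _ => ?_
        rw [Finset.sum_mul]
        refine Finset.sum_congr rfl fun M _ => ?_
        simp only [Set.indicator_apply, Set.mem_ofPred_eq, ite_mul, zero_mul]
    _ ≤ ∑ M' ∈ hS'.toFinset, δ * (∑ M ∈ hS.toFinset, wt M) * wt' M' :=
        Finset.sum_le_sum fun M' hM' => mul_le_mul_of_nonneg_right
          ((boltzmann_real_le_iff hS hne hwt).1 (hδ M' (hS'.mem_toFinset.1 hM'))) (hwt' M').le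
    _ = δ * ((∑ M ∈ hS.toFinset, wt M) * ∑ M ∈ hS'.toFinset, wt' M) := by
        rw [← Finset.mul_sum, mul_assoc]

open Classical in
/-- Two independent samples have exchangeable values of `F` on the event `r`, so the complement of
`r` bounds the difference of the expectations. -/
lemma abs_integral_boltzmann_sub_le (hS : S.Finite) (hS' : S'.Finite) (hne : S.Nonempty)
    (hne' : S'.Nonempty) (hwt : ∀ M, 0 < wt M) (hwt' : ∀ M, 0 < wt' M)
    {r : G.Config → G.Config → Prop} {F : G.Config → ℝ} {C δ : ℝ} (hC : ∀ M, |F M| ≤ C)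
    (hr : ∑ p ∈ hS.toFinset ×ˢ hS'.toFinset with r p.1 p.2,
      wt p.1 * wt' p.2 * (F p.2 - F p.1) = 0)
    (hδ : ∀ M' ∈ S', (G.boltzmann S wt).real {M | ¬ r M M'} ≤ δ) :
    |∫ M, F M ∂(G.boltzmann S' wt') - ∫ M, F M ∂(G.boltzmann S wt)| ≤ 2 * C * δ := by
  have hC0 : 0 ≤ C := (abs_nonneg _).trans (hC ∅)
  have hZ : 0 < (∑ M ∈ hS.toFinset, wt M) * ∑ M ∈ hS'.toFinset, wt' M :=
    mul_pos (sum_weight_pos hS hne hwt) (sum_weight_pos hS' hne' hwt')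
  have hterm : ∀ p : G.Config × G.Config,
      |wt p.1 * wt' p.2 * (F p.2 - F p.1)| ≤ 2 * C * (wt p.1 * wt' p.2) := fun p => by
    have hF : |F p.2 - F p.1| ≤ 2 * C := by linarith [abs_sub (F p.2) (F p.1), hC p.1, hC p.2]
    have hwt_pos := mul_pos (hwt p.1) (hwt' p.2)
    rw [abs_mul, abs_of_pos hwt_pos, mul_comm]
    exact mul_le_mul_of_nonneg_right hF hwt_pos.le
  rw [integral_boltzmann_sub hS hS' hne hne' hwt hwt', abs_div, abs_of_pos hZ, div_le_iff₀ hZ,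
    ← Finset.sum_filter_add_sum_filter_not _ (fun p => r p.1 p.2), hr, zero_add]
  calc |∑ p ∈ hS.toFinset ×ˢ hS'.toFinset with ¬ r p.1 p.2, wt p.1 * wt' p.2 * (F p.2 - F p.1)|
    _ ≤ ∑ p ∈ hS.toFinset ×ˢ hS'.toFinset with ¬ r p.1 p.2, 2 * C * (wt p.1 * wt' p.2) :=
        (Finset.abs_sum_le_sum_abs _ _).trans (Finset.sum_le_sum fun p _ => hterm p)
    _ ≤ 2 * C * (δ * ((∑ M ∈ hS.toFinset, wt M) * ∑ M ∈ hS'.toFinset, wt' M)) := by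
        rw [← Finset.mul_sum]
        exact mul_le_mul_of_nonneg_left
          (sum_filter_not_le_of_boltzmann_real_le hS hS' hne hwt hwt' hδ) (by positivity)
    _ = 2 * C * δ * ((∑ M ∈ hS.toFinset, wt M) * ∑ M ∈ hS'.toFinset, wt' M) := by ring

end Boltzmann

lemma configWeight_ite_mul {M N : G.Config} (hM : M.Finite) (hN : N.Finite) (A : Set G.Edge) :
    G.configWeight (A.ite M N) * G.configWeight (A.ite N M) =
      G.configWeight M * G.configWeight N := by
  rw [← configWeight_inter_mul_sdiff ((hM.union hN).subset (Set.ite_subset_union A M N)) A,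
    ← configWeight_inter_mul_sdiff ((hN.union hM).subset (Set.ite_subset_union A N M)) A,
    ← configWeight_inter_mul_sdiff hM A, ← configWeight_inter_mul_sdiff hN A,
    Set.ite_inter_self, Set.ite_inter_self, Set.ite_sdiff_self, Set.ite_sdiff_self]
  ring

namespace HeightPair

variable {ref : G.Edge → ℝ} {D D' : Finset V} {K : ℝ} (p : G.HeightPair ref D D' K)
  {W : Set G.Edge}
include p

open Classical in
lemma sum_exchange {F : G.Config → ℝ} (hF : DependsOnEdges W F) :
    ∑ q ∈ (G.finite_isDimer D).toFinset ×ˢ (G.finite_isDimer D').toFinset with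
      W ⊆ p.gapEdges q.1 q.2, G.configWeight q.1 * G.configWeight q.2 * (F q.2 - F q.1) = 0 := by
  set pairs := {q ∈ (G.finite_isDimer D).toFinset ×ˢ (G.finite_isDimer D').toFinset |
    W ⊆ p.gapEdges q.1 q.2}
  set swap : G.Config × G.Config → G.Config × G.Config := fun q =>
    (p.exchange q.1 q.2, p.symm.exchange q.2 q.1)
  have mem_pairs : ∀ q, q ∈ pairs ↔ (G.IsDimer (D : Set V) q.1 ∧ G.IsDimer (D' : Set V) q.2) ∧
      W ⊆ p.gapEdges q.1 q.2 := fun q => by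
    simp only [pairs, Finset.mem_filter, Finset.mem_product, Set.Finite.mem_toFinset,
      Set.mem_ofPred_eq]
  set term : G.Config × G.Config → ℝ := fun q =>
    G.configWeight q.1 * G.configWeight q.2 * (F q.2 - F q.1)
  have hterm : ∀ q ∈ pairs, term q + term (swap q) = 0 := fun q hq => by
    obtain ⟨⟨hM, hM'⟩, hW⟩ := (mem_pairs q).1 hq
    have hfst : F (p.exchange q.1 q.2) = F q.2 := hF _ _ fun e he => mem_ite_of_mem (hW he)
    have hsnd : F (p.symm.exchange q.2 q.1) = F q.1 := by
      rw [symm_exchange]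
      exact hF _ _ fun e he => mem_ite_of_mem (hW he)
    have hweight : G.configWeight (p.exchange q.1 q.2) * G.configWeight (p.symm.exchange q.2 q.1) =
        G.configWeight q.1 * G.configWeight q.2 := by
      rw [symm_exchange, exchange, mul_comm, configWeight_ite_mul hM.finite hM'.finite]
    simp only [term, swap, hfst, hsnd, hweight]
    ring
  refine Finset.sum_involution (fun q _ => swap q) hterm (fun q hq hne heq => hne ?_)
    (fun q hq => ?_) fun q hq => ?_
  · linarith [hterm q hq, congrArg term heq]
  · obtain ⟨⟨hM, hM'⟩, hW⟩ := (mem_pairs q).1 hq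
    refine (mem_pairs _).2
      ⟨⟨p.isDimer_exchange hM hM', p.symm.isDimer_exchange hM' hM⟩, hW.trans ?_⟩
    exact (p.gapEdges_exchange hM hM').ge
  · obtain ⟨⟨hM, hM'⟩, -⟩ := (mem_pairs q).1 hq
    exact Prod.ext (p.exchange_exchange hM hM') (p.symm.exchange_exchange hM' hM)

lemma dimerMeasure_real_not_subset_gapEdges_le (h0 : G.IsFaceOf (D : Set V) 0)
    (h0' : G.IsFaceOf (D' : Set V) 0) {M' : G.Config} {t : ℝ}
    (ht : ∀ M, G.IsDimer (D : Set V) M → G.IsFaceOf ((D : Set V) ∩ D') 0 →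
      K + t < |p.gap M M' 0| → W ⊆ p.gapEdges M M')
    {R ε : ℝ} (hR : 0 ≤ R) (hε : ε ∈ Set.Ico 0 1) :
    (G.dimerMeasure D).real {M | ¬ W ⊆ p.gapEdges M M'} ≤
      (G.dimerMeasure D).real {M | ¬ IsSpreadNear ref R ε M} + (⌊4 * (K + t)⌋₊ + 1) * ε := by
  calc (G.dimerMeasure D).real {M | ¬ W ⊆ p.gapEdges M M'}
    _ ≤ (G.dimerMeasure D).real ({M | ¬ IsSpreadNear ref R ε M} ∪
        {M | IsSpreadNear ref R ε M ∧ |p.snd M' 0 - p.fst M 0| ≤ K + t}) := by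
        refine boltzmann_real_mono (G.finite_isDimer D) configWeight_pos fun M hM hMW => ?_
        by_cases hspread : IsSpreadNear ref R ε M
        · obtain ⟨v, hv, hv0⟩ := h0'.2
          have hvD : v ∈ D := hspread.mem_of_pos_mem_closure_face hM hε.2 hv0
          exact Or.inr ⟨hspread, not_lt.1 fun hgap =>
            hMW (ht M hM ⟨h0.1, v, ⟨hvD, hv⟩, hv0⟩ hgap)⟩
        · exact Or.inl hspread
    _ ≤ (G.dimerMeasure D).real {M | ¬ IsSpreadNear ref R ε M} + (G.dimerMeasure D).real
        {M | IsSpreadNear ref R ε M ∧ |p.snd M' 0 - p.fst M 0| ≤ K + t} :=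
        measureReal_union_le _ _
    _ ≤ _ := add_le_add_right (dimerMeasure_real_isSpreadNear_inter_near_le
        p.isNormalizedHeight_fst h0 hR hε.1 _ _) _

lemma abs_integral_dimerMeasure_sub_le
    (hD : G.IsFaceOf (D : Set V) 0 ∧ ∃ M, G.IsDimer (D : Set V) M)
    (hD' : G.IsFaceOf (D' : Set V) 0 ∧ ∃ M, G.IsDimer (D' : Set V) M) {t : ℝ}
    (ht : ∀ M M', G.IsDimer (D : Set V) M → G.IsDimer (D' : Set V) M' →
      G.IsFaceOf ((D : Set V) ∩ D') 0 → K + t < |p.gap M M' 0| → W ⊆ p.gapEdges M M')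
    {R ε : ℝ} (hR : 0 ≤ R) (hε : ε ∈ Set.Ico 0 1) {F : G.Config → ℝ} (hF : DependsOnEdges W F)
    {C : ℝ} (hC : ∀ M, |F M| ≤ C) :
    |∫ M, F M ∂(G.dimerMeasure D') - ∫ M, F M ∂(G.dimerMeasure D)| ≤ 2 * C *
      ((G.dimerMeasure D).real {M | ¬ IsSpreadNear ref R ε M} + (⌊4 * (K + t)⌋₊ + 1) * ε) := by
  classical
  exact abs_integral_boltzmann_sub_le (G.finite_isDimer D) (G.finite_isDimer D') hD.2 hD'.2
    configWeight_pos configWeight_pos hC (p.sum_exchange hF) fun M' hM' =>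
      p.dimerMeasure_real_not_subset_gapEdges_le hD.1 hD'.1 (fun M hM => ht M M' hM hM') hR hε

end HeightPair

/-! ### Local convergence -/

lemma abs_indicator_one_le {α : Type*} (A : Set α) (x : α) :
    |A.indicator (1 : α → ℝ) x| ≤ 1 :=
  (norm_indicator_le_norm_self (1 : α → ℝ) x).trans_eq (norm_one (α := ℝ))

namespace LocallyConverges

variable {ν ν' : ℕ → Measure G.Config} {μ : Measure G.Config} (hν : G.LocallyConverges ν μ)
include hν

lemma tendsto_real {W : Set G.Edge} (hW : W.Finite) {A : Set G.Config}
    (hA : DependsOnEdges W (· ∈ A)) : Tendsto (fun n => (ν n).real A) atTop (𝓝 (μ.real A)) := by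
  have hmeas : MeasurableSet A := measurableSet_of_dependsOnEdges hW hA
  have hind : DependsOnEdges W (A.indicator (1 : G.Config → ℝ)) := fun M N h => by
    classical
    simp only [Set.indicator_apply, hA M N h, Pi.one_apply]
  simpa only [integral_indicator_one hmeas] using
    hν _ ⟨1, abs_indicator_one_le A⟩ (locallyContinuous_of_dependsOnEdges hW hind)

lemma of_tendsto_sub [∀ n, IsProbabilityMeasure (ν n)] [∀ n, IsProbabilityMeasure (ν' n)]
    (h : ∀ {W : Set G.Edge} {F : G.Config → ℝ} {C : ℝ}, W.Finite → DependsOnEdges W F →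
      (∀ M, |F M| ≤ C) → Tendsto (fun n => ∫ M, F M ∂(ν' n) - ∫ M, F M ∂(ν n)) atTop (𝓝 0)) :
    G.LocallyConverges ν' μ := by
  rintro F ⟨C, hC⟩ hF
  have hF : LocallyContinuous F := hF
  refine (tendsto_iff_of_dist ?_).1 (hν F ⟨C, hC⟩ hF)
  refine Metric.tendsto_atTop.2 fun η hη => ?_
  obtain ⟨k, hk⟩ := hF.exists_forall_abs_sub_inter_lt (η := η / 4) (by linarith)
  set F_k : G.Config → ℝ := fun M => F (M ∩ G.edgesMeeting k)
  have hF_k : DependsOnEdges (G.edgesMeeting k) F_k := dependsOnEdges_inter _ F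
  have happrox : ∀ (ρ : Measure G.Config) [IsProbabilityMeasure ρ],
      |∫ M, F M ∂ρ - ∫ M, F_k M ∂ρ| ≤ η / 4 := fun ρ _ => by
    rw [← integral_sub (.of_bound hF.measurable.aestronglyMeasurable C (ae_of_all _ hC))
      (.of_bound (measurable_of_dependsOnEdges (finite_edgesMeeting k) hF_k).aestronglyMeasurable C
        (ae_of_all _ fun M => hC _))]
    simpa only [probReal_univ, mul_one, Real.norm_eq_abs] using
      norm_integral_le_of_norm_le_const (μ := ρ) (f := fun M => F M - F_k M)
        (ae_of_all _ fun M => (hk k le_rfl M).le)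
  obtain ⟨N, hN⟩ := Metric.tendsto_atTop.1
    (h (finite_edgesMeeting k) hF_k fun M => hC _) (η / 4) (by linarith)
  refine ⟨N, fun n hn => ?_⟩
  have hlocal := hN n hn
  have happrox_ν := happrox (ν n)
  have happrox_ν' := happrox (ν' n)
  rw [Real.dist_0_eq_abs, abs_lt] at hlocal
  rw [Real.dist_0_eq_abs, abs_of_nonneg dist_nonneg, Real.dist_eq, abs_lt]
  rw [abs_le] at happrox_ν happrox_ν'
  constructor <;> linarith

end LocallyConverges

lemma SpreadOut.exists_real_not_isSpreadNear_lt {ref : G.Edge → ℝ} {μ : Measure G.Config}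
    [IsProbabilityMeasure μ] (hspread : G.SpreadOut ref μ)
    (hμ : ∀ᵐ M ∂μ, G.IsDimer Set.univ M) {ε : ℝ} (hε : 0 < ε) :
    ∃ R > 0, μ.real {M | ¬ IsSpreadNear ref R ε M} < ε := by
  obtain ⟨R, hR, hRε⟩ := hspread ε hε
  refine ⟨R, hR, ?_⟩
  have hmeas : MeasurableSet {M : G.Config | IsSpreadNear ref R ε M} :=
    measurableSet_of_dependsOnEdges (finite_edgesNear R) (dependsOnEdges_isSpreadNear ref R ε)
  have hle : μ.real {m | G.SpreadAt ref R ε m} ≤ μ.real {M | IsSpreadNear ref R ε M} := by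
    refine ENNReal.toReal_mono (measure_ne_top _ _) (measure_mono_ae ?_)
    filter_upwards [hμ] with m hm hm_spread
    exact ⟨m, hm, hm_spread, fun _ _ => Iff.rfl⟩
  change 1 - ε < μ.real {m | G.SpreadAt ref R ε m} at hRε
  rw [← Set.compl_ofPred, probReal_compl_eq_one_sub hmeas]
  linarith

/-! ### Random domains -/

lemma countable_vertex (G : PlaneBipartiteGraph V) : Countable V := by
  rw [← Set.countable_univ_iff]
  refine (Set.countable_iUnion fun n : ℕ => (G.finite_vertices n).countable).mono fun v _ => ?_
  obtain ⟨n, hn⟩ := exists_nat_ge ‖G.pos v‖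
  exact Set.mem_iUnion.2 ⟨n, hn⟩

lemma isProbabilityMeasure_dimerMeasure {D : Finset V} (hD : ∃ M, G.IsDimer (D : Set V) M) :
    IsProbabilityMeasure (G.dimerMeasure D) :=
  isProbabilityMeasure_boltzmann (G.finite_isDimer D) hD configWeight_pos

lemma measurable_comp_of_countable {Ω α β : Type*} [MeasurableSpace Ω] [MeasurableSpace β]
    [Countable α] {X : Ω → α} (hX : ∀ a, MeasurableSet {ω | X ω = a}) (f : α → β) :
    Measurable fun ω => f (X ω) := by
  let : MeasurableSpace α := ⊤
  exact measurable_from_top.comp (measurable_to_countable' hX)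

section RandomDomain

variable {Ω : Type*} [MeasurableSpace Ω] {P : Measure Ω} [IsProbabilityMeasure P]
  {D D' : Ω → Finset V}

lemma isProbabilityMeasure_randomDimerLaw (hmeas : ∀ S, MeasurableSet {ω | D ω = S})
    (hD : ∀ᵐ ω ∂P, ∃ M, G.IsDimer (D ω : Set V) M) :
    IsProbabilityMeasure (G.randomDimerLaw P D) := by
  have := G.countable_vertex
  exact isProbabilityMeasure_bind (measurable_comp_of_countable hmeas G.dimerMeasure).aemeasurable
    (hD.mono fun _ => isProbabilityMeasure_dimerMeasure)

lemma integral_randomDimerLaw (hmeas : ∀ S, MeasurableSet {ω | D ω = S})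
    (hD : ∀ᵐ ω ∂P, ∃ M, G.IsDimer (D ω : Set V) M) {F : G.Config → ℝ} (hF : Measurable F) {C : ℝ}
    (hC : ∀ M, |F M| ≤ C) :
    ∫ M, F M ∂(G.randomDimerLaw P D) = ∫ ω, ∫ M, F M ∂(G.dimerMeasure (D ω)) ∂P := by
  have := G.countable_vertex
  have := isProbabilityMeasure_randomDimerLaw hmeas hD
  let κ : ProbabilityTheory.Kernel Ω G.Config :=
    ⟨fun ω => G.dimerMeasure (D ω), measurable_comp_of_countable hmeas G.dimerMeasure⟩
  have hcomp : G.randomDimerLaw P D = (κ.comp (ProbabilityTheory.Kernel.const Unit P)) () :=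
    Measure.comp_eq_comp_const_apply (μ := P) (κ := κ)
  have hint : Integrable F (G.randomDimerLaw P D) :=
    .of_bound hF.aestronglyMeasurable C (ae_of_all _ hC)
  rw [hcomp] at hint ⊢
  rw [ProbabilityTheory.Kernel.integral_comp hint, ProbabilityTheory.Kernel.const_apply]
  rfl

lemma randomDimerLaw_real (hmeas : ∀ S, MeasurableSet {ω | D ω = S})
    (hD : ∀ᵐ ω ∂P, ∃ M, G.IsDimer (D ω : Set V) M) {A : Set G.Config} (hA : MeasurableSet A) :
    (G.randomDimerLaw P D).real A = ∫ ω, (G.dimerMeasure (D ω)).real A ∂P := by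
  simpa only [integral_indicator_one hA] using
    integral_randomDimerLaw hmeas hD (measurable_one.indicator hA) (abs_indicator_one_le A)

lemma integrable_integral_dimerMeasure (hmeas : ∀ S, MeasurableSet {ω | D ω = S})
    (hD : ∀ᵐ ω ∂P, ∃ M, G.IsDimer (D ω : Set V) M) {F : G.Config → ℝ} {C : ℝ}
    (hC : ∀ M, |F M| ≤ C) : Integrable (fun ω => ∫ M, F M ∂(G.dimerMeasure (D ω))) P := by
  have := G.countable_vertex
  refine .of_bound (measurable_comp_of_countable hmeas
    fun S => ∫ M, F M ∂(G.dimerMeasure S)).aestronglyMeasurable C ?_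
  filter_upwards [hD] with ω hω
  have := isProbabilityMeasure_dimerMeasure hω
  simpa only [probReal_univ, mul_one] using
    norm_integral_le_of_norm_le_const (μ := G.dimerMeasure (D ω)) (ae_of_all _ hC)

lemma integrable_dimerMeasure_real (hmeas : ∀ S, MeasurableSet {ω | D ω = S})
    (hD : ∀ᵐ ω ∂P, ∃ M, G.IsDimer (D ω : Set V) M) {A : Set G.Config} (hA : MeasurableSet A) :
    Integrable (fun ω => (G.dimerMeasure (D ω)).real A) P := by
  simpa only [integral_indicator_one hA] using
    integrable_integral_dimerMeasure hmeas hD (abs_indicator_one_le A)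

lemma abs_integral_randomDimerLaw_sub_le (hmeas : ∀ S, MeasurableSet {ω | D ω = S})
    (hmeas' : ∀ S, MeasurableSet {ω | D' ω = S})
    (hD : ∀ᵐ ω ∂P, G.IsFaceOf (D ω : Set V) 0 ∧ ∃ M, G.IsDimer (D ω : Set V) M)
    (hD' : ∀ᵐ ω ∂P, G.IsFaceOf (D' ω : Set V) 0 ∧ ∃ M, G.IsDimer (D' ω : Set V) M)
    {ref : G.Edge → ℝ} {K : ℝ}
    (hheights : ∀ᵐ ω ∂P, G.BoundaryHeightsWithin ref (D ω : Set V) (D' ω : Set V) K)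
    {W : Set G.Edge} (hW : W.Finite) {t : ℝ}
    (ht : ∀ ⦃S S' : Set V⦄ (p : G.HeightPair ref S S' K) ⦃M M'⦄, G.IsDimer S M → G.IsDimer S' M' →
      G.IsFaceOf (S ∩ S') 0 → K + t < |p.gap M M' 0| → W ⊆ p.gapEdges M M')
    {R ε : ℝ} (hR : 0 ≤ R) (hε : ε ∈ Set.Ico 0 1) {F : G.Config → ℝ} (hF : DependsOnEdges W F)
    {C : ℝ} (hC : ∀ M, |F M| ≤ C) :
    |∫ M, F M ∂(G.randomDimerLaw P D') - ∫ M, F M ∂(G.randomDimerLaw P D)| ≤ 2 * C *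
      ((G.randomDimerLaw P D).real {M | ¬ IsSpreadNear ref R ε M} +
        (⌊4 * (K + t)⌋₊ + 1) * ε) := by
  have hex := hD.mono fun ω => And.right
  have hex' := hD'.mono fun ω => And.right
  have hF_meas : Measurable F := measurable_of_dependsOnEdges hW hF
  have hspread_meas : MeasurableSet {M : G.Config | ¬ IsSpreadNear ref R ε M} :=
    (measurableSet_of_dependsOnEdges (finite_edgesNear R)
      (dependsOnEdges_isSpreadNear ref R ε)).compl
  rw [randomDimerLaw_real hmeas hex hspread_meas, integral_randomDimerLaw hmeas hex hF_meas hC,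
    integral_randomDimerLaw hmeas' hex' hF_meas hC,
    ← integral_sub (integrable_integral_dimerMeasure hmeas' hex' hC)
      (integrable_integral_dimerMeasure hmeas hex hC), ← Real.norm_eq_abs]
  have hint := integrable_dimerMeasure_real hmeas hex hspread_meas
  refine (norm_integral_le_of_norm_le
    ((hint.add (integrable_const ((⌊4 * (K + t)⌋₊ + 1) * ε))).const_mul (2 * C)) ?_).trans_eq ?_
  · filter_upwards [hD, hD', hheights] with ω hω hω' ⟨h, h', hn, hn', hb⟩
    let p : G.HeightPair ref (D ω) (D' ω) K := ⟨h, h', hn, hn', hb⟩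
    exact p.abs_integral_dimerMeasure_sub_le hω hω' (ht p) hR hε hF hC
  · rw [integral_const_mul, integral_add' hint (integrable_const _), integral_const,
      probReal_univ, one_smul]

end RandomDomain

/-- The gap at the origin exceeds the threshold beyond which two configurations can be exchanged on
`W`, except on an event whose probability is made small by the spread-out property. -/
lemma tendsto_integral_randomDimerLaw_sub (h0 : (0 : ℂ) ∉ G.skeleton) {ref : G.Edge → ℝ}
    {μ : Measure G.Config} [IsProbabilityMeasure μ] (hμ : ∀ᵐ M ∂μ, G.IsDimer Set.univ M)
    (hspread : G.SpreadOut ref μ)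
    {Ω : Type*} [MeasurableSpace Ω] {P : Measure Ω} [IsProbabilityMeasure P]
    {D D' : ℕ → Ω → Finset V} (hmeas : ∀ n S, MeasurableSet {ω | D n ω = S})
    (hmeas' : ∀ n S, MeasurableSet {ω | D' n ω = S})
    (hD : ∀ n, ∀ᵐ ω ∂P, G.IsFaceOf (D n ω : Set V) 0 ∧ ∃ M, G.IsDimer (D n ω : Set V) M)
    (hD' : ∀ n, ∀ᵐ ω ∂P, G.IsFaceOf (D' n ω : Set V) 0 ∧ ∃ M, G.IsDimer (D' n ω : Set V) M)
    (hconv : G.LocallyConverges (fun n => G.randomDimerLaw P (D n)) μ) {K : ℝ}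
    (hheights : ∀ n, ∀ᵐ ω ∂P,
      G.BoundaryHeightsWithin ref (D n ω : Set V) (D' n ω : Set V) K)
    {W : Set G.Edge} (hW : W.Finite) {F : G.Config → ℝ} (hF : DependsOnEdges W F) {C : ℝ}
    (hC : ∀ M, |F M| ≤ C) :
    Tendsto (fun n => ∫ M, F M ∂(G.randomDimerLaw P (D' n)) -
      ∫ M, F M ∂(G.randomDimerLaw P (D n))) atTop (𝓝 0) := by
  have hC0 : 0 ≤ C := (abs_nonneg _).trans (hC ∅)
  refine Metric.tendsto_nhds.2 fun η hη => ?_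
  obtain ⟨t, ht⟩ := (eventually_subset_gapEdges ref h0 hW).exists
  set c : ℝ := ⌊4 * (K + t)⌋₊ + 1
  obtain ⟨ε, hε0, hε⟩ : ∃ ε : ℝ, 0 < ε ∧ ε < min 1 (η / (2 * C * (1 + c) + 1)) :=
    exists_between (by positivity)
  rw [lt_min_iff, lt_div_iff₀ (by positivity)] at hε
  obtain ⟨R, hR, hμR⟩ := hspread.exists_real_not_isSpreadNear_lt hμ hε0
  have hlocal : DependsOnEdges (G.edgesNear R) (· ∈ {M | ¬ IsSpreadNear ref R ε M}) :=
    fun M N h => congrArg Not (dependsOnEdges_isSpreadNear ref R ε M N h)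
  filter_upwards [(hconv.tendsto_real (finite_edgesNear R) hlocal).eventually
    (gt_mem_nhds hμR)] with n hn
  rw [Real.dist_0_eq_abs]
  calc |∫ M, F M ∂(G.randomDimerLaw P (D' n)) - ∫ M, F M ∂(G.randomDimerLaw P (D n))|
    _ ≤ 2 * C * ((G.randomDimerLaw P (D n)).real {M | ¬ IsSpreadNear ref R ε M} + c * ε) :=
        abs_integral_randomDimerLaw_sub_le (hmeas n) (hmeas' n) (hD n) (hD' n) (hheights n) hW
          (fun _ _ p => ht p) hR.le ⟨hε0.le, hε.1⟩ hF hC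
    _ ≤ 2 * C * (ε + c * ε) := by gcongr
    _ < η := by linarith

end PlaneBipartiteGraph

theorem mainTheorem3 {V : Type*} (G : PlaneBipartiteGraph V)
    (h0 : (0 : ℂ) ∉ G.skeleton)
    (ref : G.Edge → ℝ) (href : G.IsReferenceFlow ref)
    -- the infinite volume measure
    (μ : Measure G.Config) [IsProbabilityMeasure μ]
    (hμ : ∀ᵐ M ∂μ, G.IsDimer Set.univ M)
    (hspread : G.SpreadOut ref μ)
    -- the random domains, defined on one probability space
    {Ω : Type*} [MeasurableSpace Ω] (P : Measure Ω) [IsProbabilityMeasure P]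
    (D D' : ℕ → Ω → Finset V)
    (hDmeas : ∀ n S, MeasurableSet {ω | D n ω = S})
    (hDmeas' : ∀ n S, MeasurableSet {ω | D' n ω = S})
    (hD : ∀ᵐ ω ∂P, ∀ n, G.IsFaceOf (D n ω : Set V) 0 ∧ ∃ M, G.IsDimer (D n ω : Set V) M)
    (hD' : ∀ᵐ ω ∂P, ∀ n, G.IsFaceOf (D' n ω : Set V) 0 ∧ ∃ M, G.IsDimer (D' n ω : Set V) M)
    (hconv : G.LocallyConverges (fun n => G.randomDimerLaw P (D n)) μ)
    (K : ℝ) (hK : 0 < K)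
    (hheights : ∀ᵐ ω ∂P, ∀ n,
      G.BoundaryHeightsWithin ref (D n ω : Set V) (D' n ω : Set V) K) :
    G.LocallyConverges (fun n => G.randomDimerLaw P (D' n)) μ := by
  have hex n := (ae_all_iff.1 hD n).mono fun _ => And.right
  have hex' n := (ae_all_iff.1 hD' n).mono fun _ => And.right
  have hprob n := PlaneBipartiteGraph.isProbabilityMeasure_randomDimerLaw (hDmeas n) (hex n)
  have hprob' n := PlaneBipartiteGraph.isProbabilityMeasure_randomDimerLaw (hDmeas' n) (hex' n)
  exact hconv.of_tendsto_sub fun hW hF hC =>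
    PlaneBipartiteGraph.tendsto_integral_randomDimerLaw_sub h0 hμ hspread hDmeas hDmeas'
      (ae_all_iff.1 hD) (ae_all_iff.1 hD') hconv (ae_all_iff.1 hheights) hW hF hC
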